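/- Let $Q$ be a positive-definite integral (that is, integer-valued) quadratic form on $\mathbb Z^f$ of even rank $f=2r$, with Gram matrix $A$ (integral, symmetric, with even diagonal), so that $Q(x)=\tfrac12\,x'Ax$, extended to $x\in\mathbb C^f$ by the same formula. Let $N$ be the level of $Q$, i.e. the least positive integer such that $NA^{-1}$ is integral with even diagonal. For $d>0$ let $\epsilon(d)=\left(\frac{(-1)^r\det A}{d}\right)$ be the Jacobi symbol, extended to even $d$ as the Kronecker symbol. For integers $0\le 2j\le k$ put $\gamma(j,k)=2^{-j}\binom kj\binom{k-j}{j}j!$. For $l\in\mathbb C^f$, $h\in\mathbb Z^f$, an integer $k\ge 0$ and $\tau$ in the upper half-plane put $$\theta(A,h,l,k,\tau)=\frac1{N^k}\sum_{\substack{m\in\mathbb Z^f\\ m\equiv h\ (\mathrm{mod}\ N)}}(l'Am)^k\exp\left(2\pi i\tau Q(m)/N^2\right),\qquad \theta(Q,l,k,\tau)=\sum_{m\in\mathbb Z^f}(l'Am)^k\exp(2\pi i\tau Q(m)).$$ The series $\theta(A,h,l,k,\tau)$ converge absolutely. If $Ah\equiv 0\pmod N$, and if $\gamma=\begin{pmatrix}a&b\\c&d\end{pmatrix}\in\Gamma_0(N)$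 with $d>0$, then $$(c\tau+d)^{-(r+k)}\,\theta\left(A,h,l,k,\frac{a\tau+b}{c\tau+d}\right)=\exp\left(2\pi i\,Q(h)\,ab/N^2\right)\epsilon(d)\sum_{j=0}^{\lfloor k/2\rfloor}\left(\frac{Q(l)\,c}{\pi i(c\tau+d)}\right)^{j}\gamma(j,k)\,\theta(A,ah,l,k-2j,\tau).$$ For $h=0$ one has $\theta(A,0,l,k,\tau)=\theta(Q,l,k,\tau)$, and hence, for $\gamma\in\Gamma_0(N)$ with $d>0$, $$(c\tau+d)^{-(r+k)}\,\theta\left(Q,l,k,\frac{a\tau+b}{c\tau+d}\right)=\epsilon(d)\sum_{j=0}^{\lfloor k/2\rfloor}\left(\frac{Q(l)\,c}{\pi i(c\tau+d)}\right)^{j}\gamma(j,k)\,\theta(Q,l,k-2j,\tau).$$ -/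

import Mathlib

open scoped MatrixGroups

noncomputable section

namespace ThetaTransform

/-- `A` is the Gram matrix of a positive-definite integral (that is, integer-valued) quadratic form
`Q(x) = (1/2) x' A x` on `ℤ ^ f`: it is an integral symmetric matrix, its diagonal is even, and it
is positive definite as a real matrix. -/
structure IsGram {f : ℕ} (A : Matrix (Fin f) (Fin f) ℤ) : Prop where
  symm : A.IsSymm
  even_diag : ∀ i, Even (A i i)
  posDef : (A.map (Int.cast : ℤ → ℝ)).PosDef

/-- `N` is the level of `A`: the least positive integer for which the matrix `N A⁻¹` is integral
with even diagonal. (Here `B` is `N A⁻¹`.) -/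
def IsLevel {f : ℕ} (A : Matrix (Fin f) (Fin f) ℤ) (N : ℕ) : Prop :=
  IsLeast {n : ℕ | 0 < n ∧ ∃ B : Matrix (Fin f) (Fin f) ℤ,
    A * B = (n : ℤ) • (1 : Matrix (Fin f) (Fin f) ℤ) ∧ ∀ i, Even (B i i)} N

/-- The bilinear form `⟨x, y⟩ = x' A y` on `ℂ ^ f`. -/
def bil {f : ℕ} (A : Matrix (Fin f) (Fin f) ℤ) (x y : Fin f → ℂ) : ℂ :=
  x ⬝ᵥ (A.map (Int.cast : ℤ → ℂ)).mulVec y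

/-- The quadratic form `Q(x) = (1/2) x' A x` on `ℂ ^ f`. -/
def quad {f : ℕ} (A : Matrix (Fin f) (Fin f) ℤ) (x : Fin f → ℂ) : ℂ := bil A x x / 2

/-- An integral vector, regarded as a complex vector. -/
def toC {f : ℕ} (m : Fin f → ℤ) : Fin f → ℂ := fun i => (m i : ℂ)

/-- The coset of all `m ∈ ℤ ^ f` with `m ≡ h (mod N)`. -/
def coset {f : ℕ} (N : ℕ) (h : Fin f → ℤ) : Set (Fin f → ℤ) := {m | ∀ i, m i ≡ h i [ZMOD N]}

/-- The summand `(l' A m) ^ k exp(2 π i τ Q(m) / N ^ 2)`. -/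
def thetaTerm {f : ℕ} (A : Matrix (Fin f) (Fin f) ℤ) (N : ℕ) (l : Fin f → ℂ) (k : ℕ)
    (τ : UpperHalfPlane) (m : Fin f → ℤ) : ℂ :=
  bil A l (toC m) ^ k *
    Complex.exp (2 * Real.pi * Complex.I * (τ : ℂ) * quad A (toC m) / (N : ℂ) ^ 2)

/-- `θ(A, h, l, k, τ) = N ^ (-k) ∑_{m ≡ h (N)} (l' A m) ^ k exp(2 π i τ Q(m) / N ^ 2)`. -/
def theta {f : ℕ} (A : Matrix (Fin f) (Fin f) ℤ) (N : ℕ) (h : Fin f → ℤ) (l : Fin f → ℂ) (k : ℕ)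
    (τ : UpperHalfPlane) : ℂ :=
  1 / (N : ℂ) ^ k * ∑' m : coset N h, thetaTerm A N l k τ m

/-- `θ(Q, l, k, τ) = ∑_{m ∈ ℤ ^ f} ⟨l, m⟩ ^ k exp(2 π i Q(m) τ)`. -/
def thetaQ {f : ℕ} (A : Matrix (Fin f) (Fin f) ℤ) (l : Fin f → ℂ) (k : ℕ)
    (τ : UpperHalfPlane) : ℂ :=
  ∑' m : Fin f → ℤ, bil A l (toC m) ^ k *
    Complex.exp (2 * Real.pi * Complex.I * quad A (toC m) * (τ : ℂ))

/-- `γ(j, k) = 2 ^ (-j) (k choose j) (k - j choose j) j!`, used for `2 j ≤ k` only. -/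
def gammaCoef (j k : ℕ) : ℂ :=
  (2 : ℂ)⁻¹ ^ j * (k.choose j : ℂ) * ((k - j).choose j : ℂ) * (j.factorial : ℂ)

/-- The Kronecker symbol `(a / n)` for `n > 0`, the completely multiplicative extension of the
Jacobi symbol to even `n`: with `n = 2 ^ e * n'` and `n'` odd it is `(a / 2) ^ e * J(a | n')`,
where `(a / 2)` is `0` for even `a`, `1` for `a ≡ ±1 (mod 8)` and `-1` for `a ≡ ±3 (mod 8)`.
(Mathlib's `jacobiSym` has a different value at even `n`.) -/
def kroneckerSym (a : ℤ) (n : ℕ) : ℤ :=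
  ZMod.χ₈ (a : ZMod 8) ^ padicValNat 2 n * jacobiSym a (n / 2 ^ padicValNat 2 n)

/-- The value at `d > 0` of the character `ε(d) = ((-1) ^ r det A / d)`, for `A` of rank `2 r`. -/
def epsilonChar {r : ℕ} (A : Matrix (Fin (2 * r)) (Fin (2 * r)) ℤ) (d : ℤ) : ℤ :=
  kroneckerSym ((-1) ^ r * A.det) d.toNat

end ThetaTransform

end

/-!
Throughout, `e z = exp(2πiz)`. The polynomial weights `(l' A m) ^ k` are the Taylor coefficients at
`u = 0`, along the line `ℂ l`, of the two-variable series (`jacobiForm`)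
`Θ(x, u, τ) = ∑ e(τ Q(m + x) + ⟨u, m + x⟩)`, the sum being over `m ∈ ℤ ^ f`. All the weights are
therefore treated at once by one formula, in which `x = A⁻¹ p` lies in the dual lattice
(`jacobiForm_transform`):
`Θ(x, u / (c τ + d), γ τ) =
  e(a b Q(x)) (G(b, d) / d ^ r) (c τ + d) ^ r e(c Q(u) / (c τ + d)) Θ(a x, u, τ)`,
where `G(b, d) = ∑ e(b Q(y) / d)`, over `y` modulo `d`, is the Gauss sum of the form. Comparing the
coefficients of the powers of `u` gives the theorem: the factor `e(c Q(u) / (c τ + d))` is the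
source of the sum over `j`, and the coefficients `γ(j, k)` are those of the product of two
exponential generating series (`shiftSeries_transform`).

For the formula write `γ τ = b / d + τ / (d (c τ + d))`. On a residue class of `m` modulo `d` the
rational part `b / d` contributes only a constant phase. What is left is a Gaussian sum over a
translate of the full lattice, at the argument `-1 / T` with `T = -1 / τ - c / d`. Poisson summation
(`poisson_summation`, `exists_inversion`) turns it into a sum over the dual lattice at `T`; there
the sum over the classes modulo `d` is a Gauss sum with a linear term, and completing the square
(`sum_e_intQuad_add_linear`) gives `G(b, d)` times a phase which cancels the summand `-c / d` of
`T`. A second Poisson summation leads from `-1 / τ` back to `τ`. The constant `κ` of the inversion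
formula occurs on both sides, so its value is never needed.

It remains to see that `G(b, d) / d ^ r` is `ε(d)` (`quadGaussSum_eq`). The transformation formula
applied to both `τ` and `τ + k`, at a point where the theta series does not vanish, shows that
`(b, d)` may be replaced by `(b + a k, d + c k)` (`quadGaussSum_translate`). After `c` is made
divisible by a suitable multiple of `det A`, Dirichlet's theorem on primes in progressions
yields an odd prime `p = d + c k` which does not divide `det A`. Modulo `p` the form can be
diagonalized, and its Gauss sum is a product of `2 r` classical ones (`quadGaussSum_prime`), which
gives the Legendre symbol of `(-1) ^ r det A` at `p`. Quadratic reciprocity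
identifies this symbol with the one at `d`. For even `d`, where `det A` is odd, this uses
`(-1) ^ r det A ≡ 1 (mod 4)` (`signed_det_mod_four`).
-/

noncomputable section

namespace ThetaTransform

open MeasureTheory Complex Matrix

/-! ### Poisson summation in several variables -/

theorem summable_prod_fin {n : ℕ} (f : Fin n → ℤ → ℝ) (h0 : ∀ i m, 0 ≤ f i m)
    (hf : ∀ i, Summable (f i)) : Summable fun m : Fin n → ℤ => ∏ i, f i (m i) := by
  induction n with
  | zero => exact Summable.of_finite
  | succ n ih =>
    have h := (hf 0).mul_of_nonneg (ih (fun i => f i.succ) (fun i m => h0 _ m) fun i => hf _)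
      (h0 0) (fun m => Finset.prod_nonneg fun i _ => h0 _ _)
    rw [← (Fin.consEquiv fun _ => ℤ).summable_iff]
    refine h.congr fun m => ?_
    simp [Fin.prod_univ_succ, Fin.consEquiv]

/-- The half-open unit cube with lower corner `m`. -/
def unitCube {n : ℕ} (m : Fin n → ℤ) : Set (Fin n → ℝ) :=
  {x | ∀ i, x i ∈ Set.Ioc (m i : ℝ) (m i + 1)}

theorem measurableSet_unitCube {n : ℕ} (m : Fin n → ℤ) : MeasurableSet (unitCube m) :=
  MeasurableSet.univ_pi' fun _ => measurableSet_Ioc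

theorem mem_unitCube_iff {n : ℕ} (m : Fin n → ℤ) (x : Fin n → ℝ) :
    x ∈ unitCube m ↔ m = fun i => ⌈x i⌉ - 1 := by
  simp only [unitCube, Set.mem_ofPred_eq, Set.mem_Ioc, funext_iff]
  refine forall_congr' fun i => ?_
  rw [eq_sub_iff_add_eq, eq_comm, Int.ceil_eq_iff]
  push_cast
  simp

theorem iUnion_unitCube (n : ℕ) : ⋃ m : Fin n → ℤ, unitCube m = Set.univ := by
  ext x
  simp [mem_unitCube_iff]

theorem pairwise_disjoint_unitCube (n : ℕ) :
    Pairwise (Function.onFun Disjoint fun m : Fin n → ℤ => unitCube m) := by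
  intro m m' h
  refine Set.disjoint_left.2 fun x hx hx' => h ?_
  rw [mem_unitCube_iff] at hx hx'
  rw [hx, hx']

/-- Integration over `ℝⁿ` unfolds as integration of translates over the unit cube. -/
theorem hasSum_setIntegral_unitCube {n : ℕ} {g : (Fin n → ℝ) → ℂ} (hg : Integrable g) :
    HasSum (fun m : Fin n → ℤ => ∫ x in unitCube 0, g (x + fun i => (m i : ℝ))) (∫ x, g x) := by
  have h := hasSum_integral_iUnion (μ := volume) (f := g)
    (fun m : Fin n → ℤ => measurableSet_unitCube m) (pairwise_disjoint_unitCube n)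
    (by rw [iUnion_unitCube]; exact hg.integrableOn)
  rw [iUnion_unitCube, Measure.restrict_univ] at h
  have hc : ∀ m : Fin n → ℤ, ∫ x in unitCube 0, g (x + fun i => (m i : ℝ)) =
      ∫ x in unitCube m, g x := by
    intro m
    rw [← integral_indicator (measurableSet_unitCube _),
      ← integral_indicator (measurableSet_unitCube _),
      ← integral_add_right_eq_self ((unitCube m).indicator g) (fun i => (m i : ℝ))]
    congr 1
    ext x
    have : x ∈ unitCube 0 ↔ (x + fun i => (m i : ℝ)) ∈ unitCube m := by
      simp only [unitCube, Set.mem_ofPred_eq, Set.mem_Ioc, Pi.add_apply, Pi.zero_apply]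
      refine forall_congr' fun i => ?_
      constructor <;> rintro ⟨h1, h2⟩ <;> constructor <;> push_cast at * <;> linarith
    by_cases hx : x ∈ unitCube 0
    · rw [Set.indicator_of_mem hx, Set.indicator_of_mem (this.1 hx)]
    · rw [Set.indicator_of_notMem hx, Set.indicator_of_notMem (fun h => hx (this.2 h))]
  simpa only [hc] using h

theorem mFourier_coe {n : ℕ} (k : Fin n → ℤ) (x : Fin n → ℝ) :
    UnitAddTorus.mFourier k (fun i => (x i : UnitAddCircle)) =
      cexp (2 * Real.pi * I * ∑ i, (k i : ℂ) * x i) := by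
  simp only [UnitAddTorus.mFourier, ContinuousMap.coe_mk, fourier_coe_apply]
  rw [← Complex.exp_sum, Finset.mul_sum]
  congr 1
  refine Finset.sum_congr rfl fun i _ => ?_
  push_cast
  ring

/-- **Poisson summation in several variables.** The hypothesis `hb` is the locally uniform
summability of the translates of `g`, and `hs` the summability of its Fourier transform over the
lattice. -/
theorem poisson_summation {n : ℕ} {g : (Fin n → ℝ) → ℂ} (hg : Continuous g) (hi : Integrable g)
    (hb : ∀ R : ℝ, ∃ u : (Fin n → ℤ) → ℝ, Summable u ∧ ∀ x : Fin n → ℝ, (∀ i, |x i| ≤ R) →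
      ∀ m : Fin n → ℤ, ‖g (x + fun i => (m i : ℝ))‖ ≤ u m)
    (hs : Summable fun k : Fin n → ℤ =>
      ∫ v, cexp (2 * Real.pi * I * ∑ i, ((-k i : ℤ) : ℂ) * v i) * g v) :
    ∑' m : Fin n → ℤ, g (fun i => (m i : ℝ)) =
      ∑' k : Fin n → ℤ, ∫ v, cexp (2 * Real.pi * I * ∑ i, ((-k i : ℤ) : ℂ) * v i) * g v := by
  -- the periodization `G` of `g` is continuous and descends to a function `F` on the torus
  set G : (Fin n → ℝ) → ℂ := fun x => ∑' m : Fin n → ℤ, g (x + fun i => (m i : ℝ)) with hG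
  have hGc : Continuous G := by
    rw [continuous_iff_continuousAt]
    intro x
    obtain ⟨u, hu, hub⟩ := hb (‖x‖ + 1)
    have : ContinuousOn G (Metric.ball x 1) := by
      refine continuousOn_tsum (fun m => (hg.comp (by fun_prop)).continuousOn) hu ?_
      intro m y hy
      refine hub y (fun i => ?_) m
      rw [mem_ball_iff_norm] at hy
      have h1 : ‖y i‖ ≤ ‖y‖ := norm_le_pi_norm y i
      have h2 : ‖y‖ ≤ ‖x‖ + 1 := by
        have := norm_add_le (y - x) x
        rw [sub_add_cancel] at this
        linarith
      exact h1.trans h2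
    exact this.continuousAt (Metric.ball_mem_nhds x one_pos)
  have hGp : ∀ (x : Fin n → ℝ) (m : Fin n → ℤ), G (x + fun i => (m i : ℝ)) = G x := by
    intro x m
    simp only [hG]
    rw [← (Equiv.addLeft m).tsum_eq (fun m' : Fin n → ℤ => g (x + fun i => (m' i : ℝ)))]
    refine tsum_congr fun m' => ?_
    congr 1
    ext i
    simp [add_assoc]
  set π : (Fin n → ℝ) → UnitAddTorus (Fin n) := fun x i => (x i : UnitAddCircle) with hπ
  have hq : Topology.IsQuotientMap π :=
    (IsOpenQuotientMap.piMap (fun _ : Fin n =>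
      (QuotientAddGroup.isOpenQuotientMap_mk :
        IsOpenQuotientMap ((↑) : ℝ → UnitAddCircle)))).isQuotientMap
  have hG' : ∀ x y, π x = π y → G x = G y := by
    intro x y hxy
    have : ∀ i, ∃ k : ℤ, x i = y i + k := by
      intro i
      have := congrFun hxy i
      simp only [hπ] at this
      rw [eq_comm, ← sub_eq_zero, ← AddCircle.coe_sub, AddCircle.coe_eq_zero_iff] at this
      obtain ⟨k, hk⟩ := this
      refine ⟨-k, ?_⟩
      simp only [zsmul_eq_mul, mul_one] at hk
      push_cast
      linarith
    choose k hk using this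
    rw [← hGp y k]
    congr 1
    ext i
    exact hk i
  let F : C(UnitAddTorus (Fin n), ℂ) :=
    ⟨fun t => G (Function.surjInv hq.surjective t), by
      rw [hq.continuous_iff]
      convert hGc using 1
      ext x
      exact hG' _ _ (Function.surjInv_eq hq.surjective _)⟩
  have hF : ∀ x, F (π x) = G x := fun x => hG' _ _ (Function.surjInv_eq hq.surjective _)
  -- unfolding the unit cube, the Fourier coefficients of `F` are the Fourier transform of `g`
  have hcoef : ∀ k : Fin n → ℤ, UnitAddTorus.mFourierCoeff F k =
      ∫ v, cexp (2 * Real.pi * I * ∑ i, ((-k i : ℤ) : ℂ) * v i) * g v := by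
    intro k
    have hcube : {x : Fin n → ℝ | ∀ i, x i ∈ Set.Ioc ((0 : Fin n → ℝ) i) ((0 : Fin n → ℝ) i + 1)}
        = unitCube 0 := by simp [unitCube]
    rw [UnitAddTorus.mFourierCoeff_eq_integral _ _ 0, hcube]
    set E : (Fin n → ℝ) → ℂ := fun v => cexp (2 * Real.pi * I * ∑ i, ((-k i : ℤ) : ℂ) * v i) with hE
    have hEn : ∀ v, ‖E v‖ = 1 := by
      intro v
      have : E v = cexp (((2 * Real.pi * ∑ i, ((-k i : ℤ) : ℝ) * v i : ℝ) : ℂ) * I) := by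
        simp only [hE]; congr 1; push_cast; ring
      rw [this, Complex.norm_exp_ofReal_mul_I]
    have hEc : Continuous E := by fun_prop
    have hEp : ∀ v (m : Fin n → ℤ), E (v + fun i => (m i : ℝ)) = E v := by
      intro v m
      simp only [hE]
      rw [Complex.exp_eq_exp_iff_exists_int]
      refine ⟨∑ i, (-k i) * m i, ?_⟩
      push_cast
      simp only [Pi.add_apply, Complex.ofReal_add, mul_add, Finset.sum_add_distrib,
        Complex.ofReal_intCast]
      ring
    have hint : Integrable (fun v => E v * g v) :=
      hi.bdd_mul hEc.aestronglyMeasurable (Filter.Eventually.of_forall fun v => (hEn v).le)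
    rw [← (hasSum_setIntegral_unitCube hint).tsum_eq]
    obtain ⟨u, hu, hub⟩ := hb 1
    have hfin : volume (unitCube (0 : Fin n → ℤ)) ≠ ⊤ := by
      refine ne_top_of_le_ne_top ?_ (measure_mono (t := Set.Icc (0 : Fin n → ℝ) 1) ?_)
      · exact isCompact_Icc.measure_ne_top
      · intro x hx
        simp only [unitCube, Set.mem_ofPred_eq, Set.mem_Ioc, Pi.zero_apply, Int.cast_zero,
          zero_add] at hx
        exact ⟨fun i => (hx i).1.le, fun i => (hx i).2⟩
    have hbd : ∀ m : Fin n → ℤ, ∀ x ∈ unitCube (0 : Fin n → ℤ),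
        ‖E (x + fun i => (m i : ℝ)) * g (x + fun i => (m i : ℝ))‖ ≤ u m := by
      intro m x hx
      rw [norm_mul, hEn, one_mul]
      refine hub x (fun i => ?_) m
      have := hx i
      simp only [Set.mem_Ioc, Pi.zero_apply, Int.cast_zero, zero_add] at this
      rw [abs_le]
      constructor <;> linarith [this.1, this.2]
    have hion : ∀ m : Fin n → ℤ, IntegrableOn
        (fun x => E (x + fun i => (m i : ℝ)) * g (x + fun i => (m i : ℝ))) (unitCube 0) := fun m =>
      (hint.comp_add_right (fun i => (m i : ℝ))).integrableOn
    have hsum : Summable fun m : Fin n → ℤ => ∫ x in unitCube 0,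
        ‖E (x + fun i => (m i : ℝ)) * g (x + fun i => (m i : ℝ))‖ := by
      refine Summable.of_nonneg_of_le (fun m => integral_nonneg fun x => norm_nonneg _)
        (fun m => ?_) (hu.mul_right (volume.real (unitCube (0 : Fin n → ℤ))))
      calc _ ≤ ∫ x in unitCube (0 : Fin n → ℤ), u m :=
            setIntegral_mono_on (hion m).norm (integrableOn_const hfin)
              (measurableSet_unitCube 0) (hbd m)
        _ = _ := by rw [setIntegral_const, smul_eq_mul, mul_comm]
    rw [integral_tsum_of_summable_integral_norm hion hsum]
    refine setIntegral_congr_fun (measurableSet_unitCube 0) fun x _ => ?_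
    rw [show (fun i => (x i : UnitAddCircle)) = π x from rfl, hF]
    have : UnitAddTorus.mFourier (-k) (π x) = E x := by
      rw [hπ, mFourier_coe]; simp [hE]
    rw [this, smul_eq_mul, hG, ← tsum_mul_left]
    simp only [hEp]
  have hsm : Summable (UnitAddTorus.mFourierCoeff F) := by
    rw [show UnitAddTorus.mFourierCoeff F = _ from funext hcoef]
    exact hs
  have hfin := UnitAddTorus.hasSum_mFourier_series_apply_of_summable hsm (π 0)
  rw [hF] at hfin
  have h0 : G 0 = ∑' m : Fin n → ℤ, g (fun i => (m i : ℝ)) := by simp [hG]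
  rw [← h0, ← hfin.tsum_eq]
  refine tsum_congr fun k => ?_
  rw [hcoef, hπ, mFourier_coe]
  simp

/-! ### Forms on the lattice and Gaussian bounds -/

variable {n : ℕ} {A B : Matrix (Fin n) (Fin n) ℤ} {N : ℕ}

theorem bil_add_left (A : Matrix (Fin n) (Fin n) ℤ) (x y z : Fin n → ℂ) :
    bil A (x + y) z = bil A x z + bil A y z := add_dotProduct _ _ _

theorem bil_add_right (A : Matrix (Fin n) (Fin n) ℤ) (x y z : Fin n → ℂ) :
    bil A x (y + z) = bil A x y + bil A x z := by
  rw [bil, mulVec_add, dotProduct_add]; rfl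

theorem bil_smul_left (A : Matrix (Fin n) (Fin n) ℤ) (c : ℂ) (x y : Fin n → ℂ) :
    bil A (c • x) y = c * bil A x y := smul_dotProduct _ _ _

theorem bil_smul_right (A : Matrix (Fin n) (Fin n) ℤ) (c : ℂ) (x y : Fin n → ℂ) :
    bil A x (c • y) = c * bil A x y := by
  rw [bil, mulVec_smul, dotProduct_smul]; rfl

theorem bil_comm (hA : A.IsSymm) (x y : Fin n → ℂ) : bil A x y = bil A y x := by
  have h : (A.map (Int.cast : ℤ → ℂ))ᵀ = A.map (Int.cast : ℤ → ℂ) := by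
    ext i j
    rw [transpose_apply, map_apply, map_apply, hA.apply]
  rw [bil, bil, dotProduct_mulVec, ← mulVec_transpose, h, dotProduct_comm]

theorem quad_add (hA : A.IsSymm) (x y : Fin n → ℂ) :
    quad A (x + y) = quad A x + bil A x y + quad A y := by
  simp only [quad, bil_add_left, bil_add_right, bil_comm hA y x]
  ring

theorem quad_smul (A : Matrix (Fin n) (Fin n) ℤ) (c : ℂ) (x : Fin n → ℂ) :
    quad A (c • x) = c ^ 2 * quad A x := by
  simp only [quad, bil_smul_left, bil_smul_right]
  ring

@[simp] theorem toC_add (x y : Fin n → ℤ) : toC (x + y) = toC x + toC y := by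
  ext i; simp [toC]

@[simp] theorem toC_zero : toC (0 : Fin n → ℤ) = 0 := by
  ext i; simp [toC]

@[simp] theorem toC_smul (c : ℤ) (x : Fin n → ℤ) : toC (c • x) = (c : ℂ) • toC x := by
  ext i; simp [toC]

theorem mulVec_toC (A : Matrix (Fin n) (Fin n) ℤ) (x : Fin n → ℤ) :
    (A.map (Int.cast : ℤ → ℂ)) *ᵥ toC x = toC (A *ᵥ x) := by
  ext i; simp [toC, mulVec, dotProduct]

theorem toC_dotProduct (x y : Fin n → ℤ) : toC x ⬝ᵥ toC y = ((x ⬝ᵥ y : ℤ) : ℂ) := by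
  simp [toC, dotProduct]

/-- The value `x' A x / 2` of the quadratic form at an integral vector, as an integer; the
division is exact for a Gram matrix. -/
def intQuad (A : Matrix (Fin n) (Fin n) ℤ) (x : Fin n → ℤ) : ℤ := (x ⬝ᵥ A *ᵥ x) / 2

theorem bil_toC (A : Matrix (Fin n) (Fin n) ℤ) (x y : Fin n → ℤ) :
    bil A (toC x) (toC y) = ((x ⬝ᵥ A *ᵥ y : ℤ) : ℂ) := by
  rw [bil, mulVec_toC, toC_dotProduct]

theorem even_dotProduct_mulVec (hA : A.IsSymm) (hd : ∀ i, Even (A i i)) (x : Fin n → ℤ) :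
    Even (x ⬝ᵥ A *ᵥ x) := by
  rw [← ZMod.intCast_eq_zero_iff_even]
  have h : ((x ⬝ᵥ A *ᵥ x : ℤ) : ZMod 2) =
      ∑ p : Fin n × Fin n, ((x p.1 * A p.1 p.2 * x p.2 : ℤ) : ZMod 2) := by
    rw [Fintype.sum_prod_type]
    simp [dotProduct, mulVec, Finset.mul_sum, mul_assoc]
  rw [h]
  -- modulo 2 the terms off the diagonal cancel in pairs, and those on it vanish
  refine Finset.sum_involution (fun p _ => p.swap) ?_ ?_ (fun _ _ => Finset.mem_univ _)
    (fun p _ => p.swap_swap)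
  · rintro ⟨i, j⟩ -
    have : x j * A j i * x i = x i * A i j * x j := by rw [hA.apply i j]; ring
    simp only [Prod.swap_prod_mk, this]
    exact CharTwo.add_self_eq_zero _
  · rintro ⟨i, j⟩ - hne heq
    simp only [Prod.swap_prod_mk, Prod.mk.injEq] at heq
    obtain ⟨rfl, -⟩ := heq
    refine hne ?_
    rw [ZMod.intCast_eq_zero_iff_even]
    exact ((hd _).mul_left _).mul_right _

theorem quad_toC (hA : A.IsSymm) (hd : ∀ i, Even (A i i)) (x : Fin n → ℤ) :
    quad A (toC x) = (intQuad A x : ℂ) := by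
  rw [quad, bil_toC, intQuad, Int.cast_div (even_dotProduct_mulVec hA hd x).two_dvd (by norm_num)]
  norm_num

open scoped MatrixOrder ComplexOrder in
theorem exists_transpose_mul_self {M : Matrix (Fin n) (Fin n) ℝ} (hM : M.PosDef) :
    ∃ P : Matrix (Fin n) (Fin n) ℝ, P.det ≠ 0 ∧ M = Pᵀ * P := by
  obtain ⟨P, hP⟩ := CStarAlgebra.nonneg_iff_eq_star_mul_self.mp hM.posSemidef.nonneg
  have h : M = Pᵀ * P := by rw [hP, star_eq_conjTranspose, conjTranspose_eq_transpose_of_trivial]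
  refine ⟨P, fun h0 => hM.det_pos.ne' ?_, h⟩
  rw [h, det_mul, h0, mul_zero]

theorem quad_eq_sum_sq {P : Matrix (Fin n) (Fin n) ℝ} (hP : A.map (Int.cast : ℤ → ℝ) = Pᵀ * P)
    (x : Fin n → ℂ) :
    quad A x = (∑ i, ((P.map Complex.ofReal) *ᵥ x) i ^ 2) / 2 := by
  have h : A.map (Int.cast : ℤ → ℂ) = (P.map Complex.ofReal)ᵀ * P.map Complex.ofReal := by
    ext i j
    have := congrArg Complex.ofReal (congrFun (congrFun hP i) j)
    simpa [mul_apply] using this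
  rw [quad, bil, h, ← mulVec_mulVec, dotProduct_mulVec, ← mulVec_transpose, transpose_transpose]
  simp [dotProduct, sq]

theorem mulVec_ofReal (P : Matrix (Fin n) (Fin n) ℝ) (v : Fin n → ℝ) :
    (P.map Complex.ofReal) *ᵥ (fun i => (v i : ℂ)) = fun i => ((P *ᵥ v) i : ℂ) := by
  ext i; simp [mulVec, dotProduct]

/-- The Gaussian integral of a positive definite form, up to a constant independent of the
parameter; complex translations of the variable do not change it. -/
theorem exists_integral_gaussian {r : ℕ} {A : Matrix (Fin (2 * r)) (Fin (2 * r)) ℤ}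
    (hA : IsGram A) : ∃ κ : ℂ, κ ≠ 0 ∧ ∀ τ : ℂ, 0 < τ.im → ∀ η : Fin (2 * r) → ℂ,
      Integrable (fun v : Fin (2 * r) → ℝ =>
        cexp (2 * Real.pi * I * (-1 / τ * quad A ((fun i => (v i : ℂ)) + η)))) ∧
      ∫ v : Fin (2 * r) → ℝ,
        cexp (2 * Real.pi * I * (-1 / τ * quad A ((fun i => (v i : ℂ)) + η))) =
          κ * (-I * τ) ^ r := by
  obtain ⟨P, hdet, hP⟩ := exists_transpose_mul_self hA.posDef
  refine ⟨((|P.det⁻¹| : ℝ) : ℂ), by simpa using hdet, fun τ hτ η => ?_⟩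
  have hτ0 : τ ≠ 0 := by rintro rfl; simp at hτ
  set β : ℂ := Real.pi * I / τ with hβ
  have hβre : 0 < β.re := by
    have : β = (Real.pi * (I / τ)) := by rw [hβ, mul_div_assoc]
    rw [this, Complex.re_ofReal_mul]
    refine mul_pos Real.pi_pos ?_
    rw [Complex.div_re]
    simp only [I_re, I_im, zero_mul, zero_div, one_mul, zero_add]
    exact div_pos hτ (Complex.normSq_pos.2 hτ0)
  have hβ0 : β ≠ 0 := by intro h; simp [h] at hβre
  set ζ := (P.map Complex.ofReal) *ᵥ η with hζ
  -- the substitution `y = P v` reduces to a diagonal form; `F` is the Gaussian in the variable `y`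
  set F : (Fin (2 * r) → ℝ) → ℂ := fun y => cexp (-β * ∑ i, (ζ i) ^ 2) *
    cexp (-β * ∑ i, (y i : ℂ) ^ 2 + ∑ i, (-2 * β * ζ i) * y i) with hF
  have hFe : ∀ v : Fin (2 * r) → ℝ,
      cexp (2 * Real.pi * I * (-1 / τ * quad A ((fun i => (v i : ℂ)) + η))) = F (toLin' P v) := by
    intro v
    rw [hF]
    beta_reduce
    rw [← Complex.exp_add, quad_eq_sum_sq hP, mulVec_add, mulVec_ofReal, ← hζ]
    congr 1
    simp only [Pi.add_apply, toLin'_apply, add_sq, Finset.sum_add_distrib, hβ]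
    have : ∑ i, 2 * (((P *ᵥ v) i : ℝ) : ℂ) * ζ i = 2 * ∑ i, (((P *ᵥ v) i : ℝ) : ℂ) * ζ i := by
      rw [Finset.mul_sum]; exact Finset.sum_congr rfl fun i _ => by ring
    rw [this]
    have : ∑ i, -2 * (Real.pi * I / τ) * ζ i * (((P *ᵥ v) i : ℝ) : ℂ) =
        -2 * (Real.pi * I / τ) * ∑ i, (((P *ᵥ v) i : ℝ) : ℂ) * ζ i := by
      rw [Finset.mul_sum]; exact Finset.sum_congr rfl fun i _ => by ring
    rw [this]
    field_simp
    ring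
  simp_rw [hFe]
  have hFi : Integrable F := (GaussianFourier.integrable_cexp_neg_mul_sum_add hβre _).const_mul _
  have hmap := Real.map_matrix_volume_pi_eq_smul_volume_pi hdet
  have hPm : Measurable (toLin' P) := (LinearMap.continuous_of_finiteDimensional _).measurable
  have hFs : Continuous F := by fun_prop
  constructor
  · have : Integrable F (Measure.map (toLin' P) volume) := by
      rw [hmap]; exact hFi.smul_measure ENNReal.ofReal_ne_top
    exact this.comp_measurable hPm
  · rw [← integral_map hPm.aemeasurable hFs.aestronglyMeasurable, hmap, integral_smul_measure,
      hF, integral_const_mul, GaussianFourier.integral_cexp_neg_mul_sum_add hβre,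
      ENNReal.toReal_ofReal (abs_nonneg _), Complex.real_smul]
    have h1 : (Real.pi / β : ℂ) = -I * τ := by
      rw [hβ]; field_simp [Real.pi_ne_zero]; simp
    have h2 : ((Fintype.card (Fin (2 * r)) : ℂ) / 2) = (r : ℂ) := by simp
    rw [h1, h2, Complex.cpow_natCast]
    have h3 : (∑ i, (-2 * β * ζ i) ^ 2) / (4 * β) = β * ∑ i, ζ i ^ 2 := by
      rw [Finset.mul_sum, Finset.sum_div]
      refine Finset.sum_congr rfl fun i _ => ?_
      field_simp; ring
    rw [h3, mul_left_comm (cexp _), ← Complex.exp_add]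
    simp

theorem norm_bil_le (A : Matrix (Fin n) (Fin n) ℤ) : ∃ K : ℝ, 0 ≤ K ∧
    ∀ x y : Fin n → ℂ, ‖bil A x y‖ ≤ K * ‖x‖ * ∑ i, ‖y i‖ := by
  refine ⟨∑ i, ∑ j, |(A i j : ℝ)|, by positivity, fun x y => ?_⟩
  simp only [bil, dotProduct, mulVec, map_apply]
  rw [mul_assoc, Finset.sum_mul]
  refine (norm_sum_le _ _).trans (Finset.sum_le_sum fun i _ => ?_)
  rw [norm_mul, Finset.sum_mul]
  have h1 : ‖x i‖ ≤ ‖x‖ := norm_le_pi_norm x i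
  have h2 : ‖∑ j, (A i j : ℂ) * y j‖ ≤ ∑ j, |(A i j : ℝ)| * ∑ k, ‖y k‖ := by
    refine (norm_sum_le _ _).trans (Finset.sum_le_sum fun j _ => ?_)
    rw [norm_mul, Complex.norm_intCast]
    exact mul_le_mul_of_nonneg_left
      (Finset.single_le_sum (f := fun k => ‖y k‖) (fun k _ => norm_nonneg _) (Finset.mem_univ j))
      (abs_nonneg _)
  calc _ ≤ ‖x‖ * ∑ j, |(A i j : ℝ)| * ∑ k, ‖y k‖ := by gcongr
    _ = _ := by
      rw [Finset.mul_sum]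
      exact Finset.sum_congr rfl fun j _ => by ring

/-- On the lattice the form takes real values, bounded below by a multiple of the Euclidean form. -/
theorem exists_quad_lower_bound (hA : IsGram A) : ∃ δ : ℝ, 0 < δ ∧ ∀ m : Fin n → ℤ,
    ∃ q : ℝ, quad A (toC m) = q ∧ δ * ∑ i, (m i : ℝ) ^ 2 ≤ q := by
  obtain ⟨P, hdet, hP⟩ := exists_transpose_mul_self hA.posDef
  set K : ℝ := ∑ i, ∑ j, (P⁻¹ i j) ^ 2 with hK
  have hK0 : 0 ≤ K := by positivity
  refine ⟨1 / (2 * (K + 1)), by positivity, fun m => ?_⟩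
  set y := P *ᵥ (fun i => (m i : ℝ)) with hy
  refine ⟨(∑ i, y i ^ 2) / 2, ?_, ?_⟩
  · rw [quad_eq_sum_sq hP, show toC m = fun i => (((fun i => (m i : ℝ)) i : ℝ) : ℂ) by
      ext i; simp [toC], mulVec_ofReal]
    push_cast
    rfl
  · have h1 : (fun i => (m i : ℝ)) = P⁻¹ *ᵥ y := by
      rw [hy, mulVec_mulVec, nonsing_inv_mul _ (isUnit_iff_ne_zero.2 hdet), one_mulVec]
    have h2 : ∑ i, (m i : ℝ) ^ 2 ≤ K * ∑ i, y i ^ 2 := by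
      rw [hK, Finset.sum_mul]
      refine Finset.sum_le_sum fun i _ => ?_
      have : (m i : ℝ) = ∑ j, P⁻¹ i j * y j := congrFun h1 i
      rw [this]
      exact Finset.sum_mul_sq_le_sq_mul_sq _ _ _
    have h3 : 0 ≤ ∑ i, y i ^ 2 := by positivity
    rw [div_mul_eq_mul_div, one_mul, div_le_div_iff₀ (by positivity) (by norm_num)]
    nlinarith

/-- Gaussian decay, uniformly for translations in a compact set, with room for an exponential
factor. -/
theorem exists_summable_bound (hA : IsGram A) {τ : ℂ} (hτ : 0 < τ.im) (R : ℝ) :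
    ∃ u : (Fin n → ℤ) → ℝ, Summable u ∧ ∀ ξ : Fin n → ℂ, (∀ i, ‖ξ i‖ ≤ R) → ∀ m : Fin n → ℤ,
      ‖cexp (2 * Real.pi * I * (τ * quad A (toC m + ξ)))‖ *
        Real.exp (R * ∑ i, |(m i : ℝ)|) ≤ u m := by
  wlog hR : 0 ≤ R generalizing R
  · obtain ⟨u, hu, h⟩ := this 0 le_rfl
    refine ⟨u, hu, fun ξ hξ m => ?_⟩
    refine le_trans ?_ (h ξ (fun i => (hξ i).trans (not_le.1 hR).le) m)
    gcongr
    exact (not_le.1 hR).le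
  obtain ⟨K, hK0, hK⟩ := norm_bil_le A
  obtain ⟨δ, hδ, hq⟩ := exists_quad_lower_bound hA
  set C : ℝ := Real.exp (2 * Real.pi * ‖τ‖ * (K * R * (n * R))) with hC
  set S : ℝ := ‖τ‖ * K * R + R / (2 * Real.pi) with hS
  set T : ℝ := 2 * (τ.im * δ) with hT
  refine ⟨fun m => C * ∏ i, Real.exp (-Real.pi * (T * (m i : ℝ) ^ 2 - 2 * S * |(m i : ℝ)|)),
    ((summable_prod_fin (fun _ k => Real.exp (-Real.pi * (T * (k : ℝ) ^ 2 - 2 * S * |(k : ℝ)|)))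
      (fun _ _ => (Real.exp_pos _).le) fun _ => ?_).mul_left C), fun ξ hξ m => ?_⟩
  · have := summable_pow_mul_jacobiTheta₂_term_bound S (T := T) (by positivity) 0
    simpa using this
  have hξn : ‖ξ‖ ≤ R := (pi_norm_le_iff_of_nonneg hR).2 hξ
  obtain ⟨q, hqe, hql⟩ := hq m
  have hb1 : ‖bil A (toC m) ξ‖ ≤ K * R * ∑ i, |(m i : ℝ)| := by
    rw [bil_comm hA.symm]
    refine (hK _ _).trans ?_
    have : ∑ i, ‖toC m i‖ = ∑ i, |(m i : ℝ)| := by simp [toC]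
    rw [this]
    gcongr
  have hb2 : ‖quad A ξ‖ ≤ K * R * (n * R) := by
    rw [quad, norm_div, Complex.norm_ofNat]
    have h1 : ∑ i, ‖ξ i‖ ≤ n * R := by
      refine (Finset.sum_le_sum fun i _ => hξ i).trans ?_
      simp
    have h2 : ‖bil A ξ ξ‖ ≤ K * R * (n * R) := (hK _ _).trans (by gcongr)
    linarith [norm_nonneg (bil A ξ ξ)]
  rw [Complex.norm_exp, ← Real.exp_add]
  -- the diagonal term of `Q(m + ξ)` decays; the mixed term grows at most linearly in `m`
  have hre : (2 * Real.pi * I * (τ * quad A (toC m + ξ))).re ≤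
      -(2 * Real.pi * (τ.im * q)) + 2 * Real.pi * ‖τ‖ * (‖bil A (toC m) ξ‖ + ‖quad A ξ‖) := by
    have e1 : 2 * Real.pi * I * (τ * quad A (toC m + ξ)) =
        ((2 * Real.pi * q : ℝ) : ℂ) * (I * τ) +
          2 * Real.pi * I * τ * (bil A (toC m) ξ + quad A ξ) := by
      rw [quad_add hA.symm, hqe]; push_cast; ring
    rw [e1, Complex.add_re, Complex.re_ofReal_mul]
    have e2 : (I * τ).re = -τ.im := by simp
    rw [e2]
    have e3 : (2 * Real.pi * I * τ * (bil A (toC m) ξ + quad A ξ)).re ≤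
        2 * Real.pi * ‖τ‖ * (‖bil A (toC m) ξ‖ + ‖quad A ξ‖) := by
      refine (Complex.re_le_norm _).trans ?_
      rw [norm_mul]
      have : ‖2 * (Real.pi : ℂ) * I * τ‖ = 2 * Real.pi * ‖τ‖ := by
        simp [abs_of_pos Real.pi_pos]
      rw [this]
      gcongr
      exact norm_add_le _ _
    linarith
  beta_reduce
  rw [← Real.exp_sum, hC, ← Real.exp_add, Real.exp_le_exp]
  have hsum : ∑ i, -Real.pi * (T * (m i : ℝ) ^ 2 - 2 * S * |(m i : ℝ)|) =
      -Real.pi * T * ∑ i, (m i : ℝ) ^ 2 + 2 * Real.pi * S * ∑ i, |(m i : ℝ)| := by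
    rw [Finset.mul_sum, Finset.mul_sum, ← Finset.sum_add_distrib]
    exact Finset.sum_congr rfl fun i _ => by ring
  have h5 : 2 * Real.pi * ‖τ‖ * (‖bil A (toC m) ξ‖ + ‖quad A ξ‖) ≤
      2 * Real.pi * ‖τ‖ * (K * R * ∑ i, |(m i : ℝ)| + K * R * (n * R)) := by gcongr
  have h6 : 2 * Real.pi * (τ.im * (δ * ∑ i, (m i : ℝ) ^ 2)) ≤ 2 * Real.pi * (τ.im * q) := by gcongr
  have h7 : 2 * Real.pi * S * ∑ i, |(m i : ℝ)| =
      2 * Real.pi * ‖τ‖ * (K * R * ∑ i, |(m i : ℝ)|) + R * ∑ i, |(m i : ℝ)| := by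
    rw [hS]; field_simp
  rw [hsum, h7, hT]
  linarith

theorem summable_exp_quad (hA : IsGram A) {τ : ℂ} (hτ : 0 < τ.im) (ξ : Fin n → ℂ) (R : ℝ) :
    Summable fun m : Fin n → ℤ => ‖cexp (2 * Real.pi * I * (τ * quad A (toC m + ξ)))‖ *
        Real.exp (R * ∑ i, |(m i : ℝ)|) := by
  obtain ⟨u, hu, h⟩ := exists_summable_bound hA hτ (max ‖ξ‖ R)
  refine Summable.of_nonneg_of_le (fun m => by positivity) (fun m => ?_) hu
  refine le_trans ?_ (h ξ (fun i => (norm_le_pi_norm ξ i).trans (le_max_left _ _)) m)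
  gcongr
  exact le_max_right _ _

/-! ### Theta series with an elliptic variable and their inversion -/

/-- `e z = exp(2 π i z)`. -/
def e (z : ℂ) : ℂ := cexp (2 * Real.pi * I * z)

theorem e_add (z w : ℂ) : e (z + w) = e z * e w := by
  rw [e, e, e, ← Complex.exp_add, mul_add]

theorem e_intCast (k : ℤ) : e k = 1 := by
  rw [e, Complex.exp_eq_one_iff]
  exact ⟨k, by ring⟩

theorem e_zero : e 0 = 1 := by simpa using e_intCast 0

theorem e_eq_of_sub_eq_int {z w : ℂ} (k : ℤ) (h : z = w + k) : e z = e w := by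
  rw [h, e_add, e_intCast, mul_one]

theorem continuous_quad (A : Matrix (Fin n) (Fin n) ℤ) : Continuous (quad A) := by
  unfold quad bil
  fun_prop

/-- The theta series in two variables, with characteristic `x` and elliptic variable `u`. -/
def jacobiForm (A : Matrix (Fin n) (Fin n) ℤ) (x u : Fin n → ℂ) (τ : ℂ) : ℂ :=
  ∑' m : Fin n → ℤ, e (τ * quad A (toC m + x) + bil A u (toC m + x))

theorem norm_bil_toC_add_le (A : Matrix (Fin n) (Fin n) ℤ) (u x : Fin n → ℂ) :
    ∃ K : ℝ, 0 ≤ K ∧ ∀ m : Fin n → ℤ,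
      ‖bil A u (toC m + x)‖ ≤ K * ∑ i, |(m i : ℝ)| + K * ∑ i, ‖x i‖ := by
  obtain ⟨K, hK0, hK⟩ := norm_bil_le A
  refine ⟨K * ‖u‖, by positivity, fun m => (hK _ _).trans ?_⟩
  rw [← mul_add, ← Finset.sum_add_distrib]
  refine mul_le_mul_of_nonneg_left (Finset.sum_le_sum fun i _ => ?_) (by positivity)
  refine (norm_add_le _ _).trans ?_
  simp [toC]

theorem summable_jacobiForm (hA : IsGram A) (x u : Fin n → ℂ) {τ : ℂ} (hτ : 0 < τ.im) :
    Summable fun m : Fin n → ℤ => e (τ * quad A (toC m + x) + bil A u (toC m + x)) := by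
  obtain ⟨K, hK0, hK⟩ := norm_bil_toC_add_le A u x
  refine Summable.of_norm_bounded ((summable_exp_quad hA hτ x (2 * Real.pi * K)).mul_left
    (Real.exp (2 * Real.pi * (K * ∑ i, ‖x i‖)))) fun m => ?_
  rw [e_add, norm_mul]
  change ‖cexp (2 * Real.pi * I * (τ * quad A (toC m + x)))‖ * ‖e (bil A u (toC m + x))‖ ≤ _
  rw [mul_left_comm (Real.exp _), ← Real.exp_add, e]
  refine mul_le_mul_of_nonneg_left ?_ (norm_nonneg _)
  rw [Complex.norm_exp, Real.exp_le_exp]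
  refine (Complex.re_le_norm _).trans ?_
  have : ‖2 * (Real.pi : ℂ) * I * bil A u (toC m + x)‖ =
      2 * Real.pi * ‖bil A u (toC m + x)‖ := by simp [abs_of_pos Real.pi_pos]
  rw [this]
  have := mul_le_mul_of_nonneg_left (hK m) (by positivity : 0 ≤ 2 * Real.pi)
  linarith

theorem jacobiForm_add_toC (A : Matrix (Fin n) (Fin n) ℤ) (x u : Fin n → ℂ) (τ : ℂ)
    (k : Fin n → ℤ) : jacobiForm A (toC k + x) u τ = jacobiForm A x u τ := by
  rw [jacobiForm, jacobiForm, ← (Equiv.addRight k).tsum_eq fun m : Fin n → ℤ =>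
    e (τ * quad A (toC m + x) + bil A u (toC m + x))]
  refine tsum_congr fun m => ?_
  simp [add_assoc]

/-- `A` is a Gram matrix, `N` is positive, and `B = N A⁻¹` is integral with even diagonal. -/
structure IsDualPair (A B : Matrix (Fin n) (Fin n) ℤ) (N : ℕ) : Prop where
  gram : IsGram A
  pos : 0 < N
  mul : A * B = (N : ℤ) • (1 : Matrix (Fin n) (Fin n) ℤ)
  even_diag : ∀ i, Even (B i i)

/-- The vector `A⁻¹ p` of the dual lattice, `p` being integral; it is written as `N⁻¹ B p`, where
`B = N A⁻¹`. -/
def dualVec (B : Matrix (Fin n) (Fin n) ℤ) (N : ℕ) (p : Fin n → ℤ) : Fin n → ℂ :=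
  (N : ℂ)⁻¹ • toC (B *ᵥ p)

namespace IsDualPair

theorem ne_zero (h : IsDualPair A B N) : (N : ℂ) ≠ 0 := Nat.cast_ne_zero.2 h.pos.ne'

theorem transpose_mul (h : IsDualPair A B N) : Bᵀ * A = (N : ℤ) • 1 := by
  have := congrArg Matrix.transpose h.mul
  rwa [Matrix.transpose_mul, h.gram.symm, transpose_smul, transpose_one] at this

theorem symm (h : IsDualPair A B N) : B.IsSymm := by
  have h1 : Bᵀ * (A * B) = (Bᵀ * A) * B := (Matrix.mul_assoc _ _ _).symm
  rw [h.mul, h.transpose_mul, Matrix.mul_smul, Matrix.smul_mul, Matrix.mul_one,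
    Matrix.one_mul] at h1
  exact smul_right_injective _ (by exact_mod_cast h.pos.ne' : (N : ℤ) ≠ 0) h1

theorem mul' (h : IsDualPair A B N) : B * A = (N : ℤ) • 1 := by
  have := h.transpose_mul
  rwa [h.symm] at this

theorem mulVec_mulVec (h : IsDualPair A B N) (p : Fin n → ℤ) : A *ᵥ (B *ᵥ p) = (N : ℤ) • p := by
  rw [Matrix.mulVec_mulVec, h.mul, smul_mulVec, one_mulVec]

theorem bil_dualVec (h : IsDualPair A B N) (ξ : Fin n → ℂ) (p : Fin n → ℤ) :
    bil A ξ (dualVec B N p) = ξ ⬝ᵥ toC p := by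
  rw [dualVec, bil_smul_right, bil, mulVec_toC, h.mulVec_mulVec, toC_smul, dotProduct_smul,
    smul_eq_mul, ← mul_assoc]
  simp [h.ne_zero]

theorem quad_dualVec (h : IsDualPair A B N) (p : Fin n → ℤ) :
    quad A (dualVec B N p) = (intQuad B p : ℂ) / N := by
  have h1 := quad_toC h.symm h.even_diag p
  rw [quad, bil_dualVec h, ← h1, quad, bil, mulVec_toC, dualVec, smul_dotProduct,
    dotProduct_comm, smul_eq_mul]
  ring

theorem mulVec_injective (h : IsDualPair A B N) : Function.Injective (B *ᵥ ·) := by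
  intro p q hpq
  have h1 := congrArg (A *ᵥ ·) hpq
  simp only [h.mulVec_mulVec] at h1
  exact smul_right_injective _ (by exact_mod_cast h.pos.ne' : (N : ℤ) ≠ 0) h1

theorem summable_dual (h : IsDualPair A B N) (ξ : Fin n → ℂ) {τ : ℂ} (hτ : 0 < τ.im) :
    Summable fun k : Fin n → ℤ => e (τ * quad A (dualVec B N k) + toC k ⬝ᵥ ξ) := by
  have hτ' : 0 < (τ / (N : ℂ) ^ 2).im := by
    have : τ / (N : ℂ) ^ 2 = (((N : ℝ) ^ 2)⁻¹ : ℝ) * τ := by push_cast; field_simp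
    rw [this, Complex.im_ofReal_mul]
    have : (0 : ℝ) < N := by exact_mod_cast h.pos
    positivity
  -- the dual series is the part of a theta series for `A` at `τ / N²` which is supported on `B ℤⁿ`
  refine ((summable_jacobiForm h.gram 0 ((N : ℂ)⁻¹ • ξ) hτ').comp_injective
    h.mulVec_injective).congr fun k => ?_
  simp only [Function.comp, add_zero]
  rw [dotProduct_comm, ← h.bil_dualVec ξ k, dualVec, quad_smul, bil_smul_left, bil_smul_right]
  congr 1
  field_simp

end IsDualPair

theorem im_neg_one_div {τ : ℂ} (hτ : 0 < τ.im) : 0 < (-1 / τ).im := by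
  have hτ0 : τ ≠ 0 := by rintro rfl; simp at hτ
  rw [neg_div, Complex.neg_im, one_div, Complex.inv_im, neg_div, neg_neg]
  exact div_pos hτ (Complex.normSq_pos.2 hτ0)

/-- The inversion formula: Poisson summation for the Gaussian of the quadratic form. The constant
`κ` depends on neither `τ` nor `ξ`. -/
theorem exists_inversion {r : ℕ} {A B : Matrix (Fin (2 * r)) (Fin (2 * r)) ℤ}
    (h : IsDualPair A B N) : ∃ κ : ℂ, κ ≠ 0 ∧ ∀ τ : ℂ, 0 < τ.im → ∀ ξ : Fin (2 * r) → ℂ,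
      ∑' m : Fin (2 * r) → ℤ, e (-1 / τ * quad A (toC m + ξ)) =
        κ * (-I * τ) ^ r * ∑' k : Fin (2 * r) → ℤ, e (τ * quad A (dualVec B N k) + toC k ⬝ᵥ ξ) := by
  obtain ⟨κ, hκ, hgauss⟩ := exists_integral_gaussian h.gram
  refine ⟨κ, hκ, fun τ hτ ξ => ?_⟩
  have hτ0 : τ ≠ 0 := by rintro rfl; simp at hτ
  have hτ' := im_neg_one_div hτ
  set g : (Fin (2 * r) → ℝ) → ℂ := fun v => e (-1 / τ * quad A ((fun i => (v i : ℂ)) + ξ)) with hg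
  have hgc : Continuous g := by
    refine Complex.continuous_exp.comp (continuous_const.mul (continuous_const.mul
      ((continuous_quad A).comp ?_)))
    fun_prop
  have hcoef : ∀ k : Fin (2 * r) → ℤ,
      ∫ v, cexp (2 * Real.pi * I * ∑ i, ((-k i : ℤ) : ℂ) * v i) * g v =
        κ * (-I * τ) ^ r * e (τ * quad A (dualVec B N k) + toC k ⬝ᵥ ξ) := by
    intro k
    -- completing the square is a complex translation, which does not change the integral
    rw [← (hgauss τ hτ (ξ + τ • dualVec B N k)).2, mul_comm (integral _ _),
      ← integral_const_mul]
    refine integral_congr_ae (Filter.Eventually.of_forall fun v => ?_)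
    change e _ * e _ = e _ * e _
    rw [← e_add, ← e_add]
    congr 1
    rw [← add_assoc, quad_add h.gram.symm _ (τ • dualVec B N k), bil_smul_right, quad_smul,
      h.bil_dualVec, add_dotProduct, dotProduct_comm (toC k) ξ]
    have : ∑ i, ((-k i : ℤ) : ℂ) * v i = -((fun i => (v i : ℂ)) ⬝ᵥ toC k) := by
      simp [dotProduct, toC, mul_comm]
    rw [this]
    field_simp
    ring
  have hP := poisson_summation hgc (hgauss τ hτ ξ).1 (fun R => ?_) ?_
  · simp_rw [hcoef] at hP
    rw [tsum_mul_left] at hP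
    rw [← hP]
    refine tsum_congr fun m => ?_
    simp only [hg, Complex.ofReal_intCast]
    rfl
  · obtain ⟨u, hu, hub⟩ := exists_summable_bound h.gram hτ' (|R| + ‖ξ‖)
    refine ⟨u, hu, fun x hx m => ?_⟩
    have h1 := hub ((fun i => (x i : ℂ)) + ξ) (fun i => ?_) m
    · refine le_trans ?_ h1
      have h2 : g (x + fun i => (m i : ℝ)) = cexp (2 * Real.pi * I * (-1 / τ *
          quad A (toC m + ((fun i => (x i : ℂ)) + ξ)))) := by
        rw [hg]
        simp only [e]
        congr 4
        ext i
        simp [toC]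
        ring
      rw [h2]
      refine le_mul_of_one_le_right (norm_nonneg _) (Real.one_le_exp ?_)
      positivity
    · refine (norm_add_le _ _).trans (add_le_add ?_ (norm_le_pi_norm ξ i))
      rw [Complex.norm_real]
      exact (hx i).trans (le_abs_self R)
  · simp_rw [hcoef]
    exact (h.summable_dual ξ hτ).mul_left _

/-- The canonical representative in `ℤⁿ` of a vector modulo `d`. -/
def lift {d : ℕ} (y : Fin n → ZMod d) : Fin n → ℤ := fun i => ((y i).val : ℤ)

/-- Division with remainder, coordinate by coordinate. -/
def residueEquiv (n d : ℕ) [NeZero d] : (Fin n → ZMod d) × (Fin n → ℤ) ≃ (Fin n → ℤ) where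
  toFun p := lift p.1 + (d : ℤ) • p.2
  invFun m := (fun i => (m i : ZMod d), fun i => m i / d)
  left_inv p := by
    have hd : (d : ℤ) ≠ 0 := by exact_mod_cast NeZero.ne d
    ext i
    · simp [lift]
    · have h0 : (0 : ℤ) ≤ (p.1 i).val := by positivity
      have h1 : ((p.1 i).val : ℤ) < d := by exact_mod_cast ZMod.val_lt _
      change ((p.1 i).val + d * p.2 i : ℤ) / d = p.2 i
      rw [Int.add_mul_ediv_left _ _ hd, Int.ediv_eq_zero_of_lt h0 h1, zero_add]
  right_inv m := by
    ext i
    change (((m i : ZMod d).val : ℤ) + d * (m i / d)) = m i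
    rw [ZMod.val_intCast, Int.emod_add_mul_ediv]

/-- A sum over the residues modulo `d` is invariant under translation. -/
theorem sum_lift_sub {d : ℕ} [NeZero d] (F : (Fin n → ℤ) → ℂ)
    (hF : ∀ m m' : Fin n → ℤ, (∀ i, (m i : ZMod d) = m' i) → F m = F m') (s : Fin n → ℤ) :
    ∑ y : Fin n → ZMod d, F (lift y - s) = ∑ y : Fin n → ZMod d, F (lift y) := by
  rw [← (Equiv.subRight fun i => (s i : ZMod d)).sum_comp fun y => F (lift y)]
  refine Finset.sum_congr rfl fun y _ => hF _ _ fun i => ?_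
  simp [lift]

/-- The Gauss sum `∑_y exp(2 π i b Q(y) / d)` of the quadratic form, over the vectors modulo `d`. -/
def quadGaussSum (A : Matrix (Fin n) (Fin n) ℤ) (b : ℤ) (d : ℕ) [NeZero d] : ℂ :=
  ∑ y : Fin n → ZMod d, e (b * intQuad A (lift y) / d)

theorem two_mul_intQuad (hA : IsGram A) (x : Fin n → ℤ) : 2 * intQuad A x = x ⬝ᵥ A *ᵥ x :=
  Int.mul_ediv_cancel' (even_dotProduct_mulVec hA.symm hA.even_diag x).two_dvd

/-- `exp(2 π i b Q(m) / d)` only depends on `m` modulo `d`, since `Q` is integer-valued. -/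
theorem e_intQuad_congr (hA : IsGram A) (b : ℤ) {d : ℕ} [NeZero d] {m m' : Fin n → ℤ}
    (hm : ∀ i, (m i : ZMod d) = m' i) :
    e (b * intQuad A m / d) = e (b * intQuad A m' / d) := by
  have hd : (d : ℂ) ≠ 0 := Nat.cast_ne_zero.2 (NeZero.ne d)
  have : ∃ k : Fin n → ℤ, m = m' + (d : ℤ) • k := by
    have : ∀ i, ∃ k : ℤ, m i = m' i + d * k := by
      intro i
      obtain ⟨k, hk⟩ := (ZMod.intCast_eq_intCast_iff_dvd_sub _ _ d).1 (hm i).symm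
      exact ⟨k, by linarith⟩
    choose k hk using this
    exact ⟨k, funext hk⟩
  obtain ⟨k, rfl⟩ := this
  refine e_eq_of_sub_eq_int (b * (m' ⬝ᵥ A *ᵥ k + d * intQuad A k)) ?_
  rw [← quad_toC hA.symm hA.even_diag, toC_add, quad_add hA.symm, toC_smul, quad_smul,
    bil_smul_right, bil_toC, quad_toC hA.symm hA.even_diag, quad_toC hA.symm hA.even_diag]
  push_cast
  field_simp
  ring

/-- Completing the square: a linear term in the Gauss sum only contributes a phase. Modulo `d` one
has `b c ≡ -1`, so the linear form `k` is removed by the translation by `c A⁻¹ k`, which is integral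
because `N` divides `c`. -/
theorem sum_e_intQuad_add_linear (h : IsDualPair A B N) {a b c : ℤ} {d : ℕ} [NeZero d]
    (hdet : a * d - b * c = 1) (hc : (N : ℤ) ∣ c) (k : Fin n → ℤ) :
    ∑ y : Fin n → ZMod d, e (b * intQuad A (lift y) / d) * e ((toC k ⬝ᵥ toC (lift y)) / d) =
      e (c / d * quad A (dualVec B N k)) * quadGaussSum A b d := by
  have hd : (d : ℂ) ≠ 0 := Nat.cast_ne_zero.2 (NeZero.ne d)
  obtain ⟨c', rfl⟩ := hc
  have hN := h.ne_zero
  set q : ℤ := c' * intQuad B k with hq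
  rw [quadGaussSum, ← sum_lift_sub (fun m => e (b * intQuad A m / d))
    (fun m m' hm => e_intQuad_congr h.gram b hm) (c' • (B *ᵥ k)), Finset.mul_sum]
  refine Finset.sum_congr rfl fun y _ => ?_
  rw [← e_add, ← e_add]
  set Y := lift y
  refine e_eq_of_sub_eq_int (a * (k ⬝ᵥ Y) - a * q) ?_
  have h1 : intQuad A (Y - c' • (B *ᵥ k)) = intQuad A Y - c' * N * (k ⬝ᵥ Y) + c' * N * q := by
    have e1 := two_mul_intQuad h.gram (Y - c' • (B *ᵥ k))
    have e2 := two_mul_intQuad h.gram Y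
    have e3 : 2 * intQuad B k = k ⬝ᵥ B *ᵥ k :=
      Int.mul_ediv_cancel' (even_dotProduct_mulVec h.symm h.even_diag k).two_dvd
    have e4 : (B *ᵥ k) ⬝ᵥ (A *ᵥ Y) = N * (k ⬝ᵥ Y) := by
      rw [dotProduct_mulVec, ← mulVec_transpose, h.gram.symm, h.mulVec_mulVec, smul_dotProduct,
        smul_eq_mul]
    simp only [mulVec_sub, mulVec_smul, h.mulVec_mulVec, dotProduct_sub, sub_dotProduct,
      dotProduct_smul, smul_dotProduct, smul_eq_mul, e4, ← e2,
      dotProduct_comm _ k, ← e3] at e1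
    rw [hq]
    linarith
  rw [h1, h.quad_dualVec, toC_dotProduct]
  have hdet' : (a : ℂ) * d - b * (N * c') = 1 := by exact_mod_cast hdet
  rw [hq]
  push_cast
  field_simp
  linear_combination -((k ⬝ᵥ Y : ℤ) - (c' : ℂ) * intQuad B k) * hdet'

theorem dualVec_smul (B : Matrix (Fin n) (Fin n) ℤ) (N : ℕ) (a : ℤ) (p : Fin n → ℤ) :
    dualVec B N (a • p) = (a : ℂ) • dualVec B N p := by
  rw [dualVec, mulVec_smul, toC_smul, smul_comm, dualVec]

/-! ### The transformation formula with a Gauss sum as multiplier -/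

/-- The part `b / d` of the argument only sees `m` modulo `d`, for a characteristic which is `a d`
times a vector of the dual lattice. -/
theorem e_rational_part (h : IsDualPair A B N) {a b c : ℤ} {d : ℕ} [NeZero d]
    (hdet : a * d - b * c = 1) (hc : (N : ℤ) ∣ c) (p m : Fin n → ℤ) :
    e (b / d * quad A (toC m + ((a * d : ℤ) : ℂ) • dualVec B N p)) =
      e (a * b * quad A (dualVec B N p)) * e (b * intQuad A m / d) := by
  have hd : (d : ℂ) ≠ 0 := Nat.cast_ne_zero.2 (NeZero.ne d)
  obtain ⟨c', rfl⟩ := hc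
  have hN := h.ne_zero
  rw [← e_add]
  refine e_eq_of_sub_eq_int (a * b * (m ⬝ᵥ p) + a * b ^ 2 * c' * intQuad B p) ?_
  have hdet' : (a : ℂ) * d - b * (N * c') = 1 := by exact_mod_cast hdet
  rw [quad_add h.gram.symm, quad_smul, bil_smul_right, h.bil_dualVec, h.quad_dualVec,
    toC_dotProduct, quad_toC h.gram.symm h.gram.even_diag]
  push_cast
  field_simp
  linear_combination (a : ℂ) * b * d * intQuad B p * hdet'

/-- The transformation formula of the theta series under `Γ₀(N)`, with the multiplier given by a
Gauss sum modulo `d`. -/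
theorem jacobiForm_transform {r : ℕ} {A B : Matrix (Fin (2 * r)) (Fin (2 * r)) ℤ}
    (h : IsDualPair A B N) {a b c : ℤ} {d : ℕ} [NeZero d]
    (hdet : a * d - b * c = 1) (hc : (N : ℤ) ∣ c) (p : Fin (2 * r) → ℤ) (u : Fin (2 * r) → ℂ)
    {τ : ℂ} (hτ : 0 < τ.im) :
    jacobiForm A (dualVec B N p) ((c * τ + d)⁻¹ • u) ((a * τ + b) / (c * τ + d)) =
      e (a * b * quad A (dualVec B N p)) * (quadGaussSum A b d / d ^ r) * (c * τ + d) ^ r *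
        e (c * quad A u / (c * τ + d)) * jacobiForm A (dualVec B N (a • p)) u τ := by
  have hd : (d : ℂ) ≠ 0 := Nat.cast_ne_zero.2 (NeZero.ne d)
  have hdpos : (0 : ℝ) < d := by exact_mod_cast Nat.pos_of_ne_zero (NeZero.ne d)
  have hτ0 : τ ≠ 0 := by rintro rfl; simp at hτ
  have hdet' : (a : ℂ) * d - b * c = 1 := by exact_mod_cast hdet
  set J : ℂ := c * τ + d with hJ
  set x := dualVec B N p with hx
  have hτ' := im_neg_one_div hτ
  -- `(a τ + b) / J = b / d + (-1 / T) / d ^ 2`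
  set T : ℂ := -J / (d * τ) with hT
  have hTe : T = -1 / τ + ((-(c : ℝ) / d : ℝ) : ℂ) := by
    rw [hT, hJ]; push_cast; field_simp; ring
  have hTim : 0 < T.im := by
    rw [hTe, Complex.add_im, Complex.ofReal_im, add_zero]; exact hτ'
  have hT0 : T ≠ 0 := by intro h0; simp [h0] at hTim
  have hJ0 : J ≠ 0 := by intro h0; simp [hT, h0] at hT0
  obtain ⟨κ, hκ, hinv⟩ := exists_inversion h
  -- since `a d ≡ 1 (mod N)`, the characteristic may be replaced by a multiple of `d`
  have hshift : jacobiForm A x (J⁻¹ • u) ((a * τ + b) / J) =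
      jacobiForm A (((a * d : ℤ) : ℂ) • x) (J⁻¹ • u) ((a * τ + b) / J) := by
    obtain ⟨c', rfl⟩ := hc
    rw [← jacobiForm_add_toC A x _ _ ((b * c') • (B *ᵥ p))]
    congr 1
    have : ((a * d : ℤ) : ℂ) = 1 + (b * c' : ℤ) * (N : ℂ) := by
      push_cast at hdet' ⊢; linear_combination hdet'
    rw [this, add_smul, one_smul, add_comm, toC_smul, mul_smul]
    congr 2
    rw [hx, dualVec, smul_smul, mul_inv_cancel₀ h.ne_zero, one_smul]
  have hγim : 0 < ((a * τ + b) / J).im := by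
    have e1 : (a * τ + b) / J = ((b / d : ℝ) : ℂ) + (((d : ℝ) ^ 2)⁻¹ : ℝ) * (-1 / T) := by
      rw [hT]
      push_cast
      field_simp
      linear_combination τ * hdet' - (b : ℂ) * hJ
    rw [e1, Complex.add_im, Complex.ofReal_im, zero_add, Complex.im_ofReal_mul]
    exact mul_pos (by positivity) (im_neg_one_div hTim)
  rw [hshift, jacobiForm, ← (residueEquiv (2 * r) d).tsum_eq]
  have hsum := (residueEquiv (2 * r) d).summable_iff.2
    (summable_jacobiForm h.gram (((a * d : ℤ) : ℂ) • x) (J⁻¹ • u) hγim)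
  rw [Function.comp_def] at hsum
  rw [hsum.tsum_prod, tsum_fintype]
  -- the terms of one residue class modulo `d`
  have hterm : ∀ (y : Fin (2 * r) → ZMod d) (m : Fin (2 * r) → ℤ),
      e ((a * τ + b) / J * quad A (toC (residueEquiv (2 * r) d (y, m)) + ((a * d : ℤ) : ℂ) • x) +
        bil A (J⁻¹ • u) (toC (residueEquiv (2 * r) d (y, m)) + ((a * d : ℤ) : ℂ) • x)) =
      e (a * b * quad A x) * e (-(d * quad A u / (τ * J))) * e (b * intQuad A (lift y) / d) *
        e (-1 / T * quad A (toC m + ((a : ℂ) • x + τ⁻¹ • u + (d : ℂ)⁻¹ • toC (lift y)))) := by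
    intro y m
    set M := residueEquiv (2 * r) d (y, m) with hM
    have hMe : M = lift y + (d : ℤ) • m := rfl
    set V := toC M + ((a * d : ℤ) : ℂ) • x with hV
    have hVe : V = (d : ℂ) • (toC m + ((a : ℂ) • x + (d : ℂ)⁻¹ • toC (lift y))) := by
      rw [hV, hMe, toC_add, toC_smul, smul_add, smul_add, smul_smul (d : ℂ) (d : ℂ)⁻¹,
        mul_inv_cancel₀ hd, one_smul, smul_smul]
      push_cast
      rw [mul_comm (a : ℂ)]
      abel
    have hres : e (b * intQuad A M / d) = e (b * intQuad A (lift y) / d) :=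
      e_intQuad_congr h.gram b fun i => by simp [hMe]
    rw [← hres, mul_right_comm (e (a * b * quad A x)), ← e_rational_part h hdet hc p M, ← hx, ← hV,
      ← e_add, ← e_add]
    congr 1
    have h1 : toC m + ((a : ℂ) • x + τ⁻¹ • u + (d : ℂ)⁻¹ • toC (lift y)) =
        (d : ℂ)⁻¹ • V + τ⁻¹ • u := by
      rw [hVe, smul_smul, inv_mul_cancel₀ hd, one_smul]
      abel
    rw [h1, quad_add h.gram.symm ((d : ℂ)⁻¹ • V), quad_smul, quad_smul, bil_smul_left,
      bil_smul_right, bil_smul_left, bil_comm h.gram.symm u V, hT]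
    have hdJ : a * τ + b = b / d * J + τ / d := by
      rw [hJ]; field_simp; linear_combination τ * hdet'
    rw [hdJ]
    field_simp
    ring
  simp_rw [hterm, tsum_mul_left, hinv T hTim]
  -- interchange the finite sum with the dual series, and evaluate the finite sum
  have hdual : ∑ y : Fin (2 * r) → ZMod d, e (b * intQuad A (lift y) / d) *
      ∑' k : Fin (2 * r) → ℤ, e (T * quad A (dualVec B N k) +
        toC k ⬝ᵥ ((a : ℂ) • x + τ⁻¹ • u + (d : ℂ)⁻¹ • toC (lift y))) =
      quadGaussSum A b d * ∑' k : Fin (2 * r) → ℤ, e (-1 / τ * quad A (dualVec B N k) +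
        toC k ⬝ᵥ ((a : ℂ) • x + τ⁻¹ • u)) := by
    simp_rw [← tsum_mul_left]
    rw [← Summable.tsum_finsetSum fun y _ => (h.summable_dual _ hTim).mul_left _]
    refine tsum_congr fun k => ?_
    have h1 := sum_e_intQuad_add_linear h hdet hc k
    have h2 : e (T * quad A (dualVec B N k) + toC k ⬝ᵥ ((a : ℂ) • x + τ⁻¹ • u)) *
        e (c / d * quad A (dualVec B N k)) =
        e (-1 / τ * quad A (dualVec B N k) + toC k ⬝ᵥ ((a : ℂ) • x + τ⁻¹ • u)) := by
      rw [← e_add, hTe]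
      congr 1
      push_cast
      ring
    rw [← h2, mul_left_comm, mul_comm (quadGaussSum A b d), ← h1, Finset.mul_sum]
    refine Finset.sum_congr rfl fun y _ => ?_
    rw [dotProduct_add _ _ ((d : ℂ)⁻¹ • toC (lift y)), dotProduct_smul, ← add_assoc,
      e_add _ (_ • _), smul_eq_mul, inv_mul_eq_div]
    ring
  -- the second inversion, from `-1 / τ` back to `τ`
  have hback := hinv (-1 / τ) hτ' ((a : ℂ) • x + τ⁻¹ • u)
  have hjac : ∑' m : Fin (2 * r) → ℤ, e (-1 / (-1 / τ) * quad A (toC m + ((a : ℂ) • x + τ⁻¹ • u))) =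
      e (quad A u / τ) * jacobiForm A (dualVec B N (a • p)) u τ := by
    rw [jacobiForm, ← tsum_mul_left]
    refine tsum_congr fun m => ?_
    rw [← e_add, dualVec_smul, ← hx, ← add_assoc, quad_add h.gram.symm _ (τ⁻¹ • u), bil_smul_right,
      quad_smul, bil_comm h.gram.symm _ u]
    congr 1
    field_simp
    ring
  rw [hjac] at hback
  have hcollect : ∀ (C D E : ℂ) (S F : (Fin (2 * r) → ZMod d) → ℂ),
      ∑ y, C * S y * (D * E * F y) = C * D * E * ∑ y, S y * F y := by
    intro C D E S F
    rw [Finset.mul_sum]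
    exact Finset.sum_congr rfl fun y _ => by ring
  rw [hcollect, hdual]
  have hTJ : (-I * T) ^ r = (-I * (-1 / τ)) ^ r * J ^ r / d ^ r := by
    rw [← mul_pow, ← div_pow]
    congr 1
    rw [hT]
    field_simp
  have hee : e (c * quad A u / J) = e (-(d * quad A u / (τ * J))) * e (quad A u / τ) := by
    rw [← e_add]
    congr 1
    rw [hJ] at hJ0 ⊢
    field_simp
    ring
  rw [hTJ, hee]
  linear_combination (e (a * b * quad A x) * e (-(d * quad A u / (τ * J))) *
    (J ^ r / d ^ r) * quadGaussSum A b d) * (-hback)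

/-! ### Gauss sums of quadratic forms modulo an odd prime -/

section FiniteField

theorem exists_diagonalization {F : Type} [Field F] (hF : ringChar F ≠ 2) {n : ℕ}
    {M : Matrix (Fin n) (Fin n) F} (hM : M.IsSymm) :
    ∃ (P : Matrix (Fin n) (Fin n) F) (w : Fin n → F), P.det ≠ 0 ∧ Pᵀ * M * P = diagonal w := by
  have : Invertible (2 : F) := invertibleOfNonzero (Ring.two_ne_zero hF)
  set b := Pi.basisFun F (Fin n)
  have hsymm : (Matrix.toBilin b M).IsSymm := by
    rw [← LinearMap.BilinForm.isSymm_toMatrix_iff_isSymm (b := b),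
      LinearMap.BilinForm.toMatrix_toBilin]
    exact hM
  obtain ⟨v, hv⟩ := LinearMap.BilinForm.exists_orthogonal_basis (K := F) (V := Fin n → F)
    (B := Matrix.toBilin b M) ⟨hsymm.eq⟩
  set c := v.reindex (finCongr (Module.finrank_fin_fun F (n := n))) with hc
  have h := LinearMap.BilinForm.toMatrix_mul_basis_toMatrix b c (Matrix.toBilin b M)
  rw [LinearMap.BilinForm.toMatrix_toBilin] at h
  refine ⟨b.toMatrix c, fun i => Matrix.toBilin b M (c i) (c i), ?_, ?_⟩
  · intro h0
    have h1 := congrArg Matrix.det (Module.Basis.toMatrix_mul_toMatrix_flip b c)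
    rw [det_mul, h0, zero_mul, det_one] at h1
    exact zero_ne_one h1
  · rw [h]
    ext i j
    rw [LinearMap.BilinForm.toMatrix_apply]
    by_cases hij : i = j
    · subst hij; simp
    · rw [diagonal_apply_ne _ hij, hc]
      simp only [Module.Basis.reindex_apply]
      exact hv (fun h' => hij (by simpa using h'))

theorem addChar_sum {G ι : Type} [AddCommMonoid G] (ψ : AddChar G ℂ) (s : Finset ι) (f : ι → G) :
    ψ (∑ i ∈ s, f i) = ∏ i ∈ s, ψ (f i) := by
  classical
  induction s using Finset.induction_on with
  | empty => simp
  | insert i s hi ih => rw [Finset.sum_insert hi, Finset.prod_insert hi, AddChar.map_add_eq_mul, ih]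

variable {F : Type} [Field F] [Fintype F] [DecidableEq F]

/-- The quadratic character of a finite field, with complex values. -/
abbrev complexQuadraticChar (F : Type) [Field F] [Fintype F] [DecidableEq F] : MulChar F ℂ :=
  (quadraticChar F).ringHomComp (Int.castRingHom ℂ)

/-- The one-dimensional quadratic Gauss sum, expressed by that of the quadratic character: `s` is a
square in `χ(s) + 1` ways. -/
theorem sum_addChar_mul_sq (hF : ringChar F ≠ 2) {ψ : AddChar F ℂ} (hψ : ψ.IsPrimitive) {a : F}
    (ha : a ≠ 0) :
    ∑ t : F, ψ (a * t ^ 2) = (quadraticChar F a : ℂ) * gaussSum (complexQuadraticChar F) ψ := by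
  have h1 : ∑ t : F, ψ (a * t ^ 2) = ∑ s : F, ((quadraticChar F s : ℂ) + 1) * ψ (a * s) := by
    rw [← Finset.sum_fiberwise Finset.univ (fun t : F => t ^ 2)]
    refine Finset.sum_congr rfl fun s _ => ?_
    have hcard := quadraticChar_card_sqrts hF s
    have : ({x : F | x ^ 2 = s}.toFinset) = Finset.univ.filter fun t : F => t ^ 2 = s := by
      ext; simp
    rw [this] at hcard
    rw [Finset.sum_congr rfl (g := fun _ => ψ (a * s)) fun t ht => by
      rw [(Finset.mem_filter.1 ht).2], Finset.sum_const, nsmul_eq_mul]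
    congr 1
    exact_mod_cast hcard
  have h2 : ∑ s : F, ψ (a * s) = 0 := by
    have := AddChar.sum_mulShift a hψ
    simp_rw [mul_comm _ a] at this
    rw [this, if_neg ha]
    simp
  have h3 := gaussSum_mulShift (complexQuadraticChar F) ψ (Units.mk0 a ha)
  simp only [Units.val_mk0] at h3
  have h4 : ((quadraticChar F a : ℤ) : ℂ) * (quadraticChar F a : ℤ) = 1 := by
    have := quadraticChar_sq_one ha
    rw [sq] at this
    exact_mod_cast this
  have h5 : ∑ s : F, (quadraticChar F s : ℂ) * ψ (a * s) =
      gaussSum (complexQuadraticChar F) (ψ.mulShift a) := by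
    simp [gaussSum, AddChar.mulShift_apply]
  rw [h1]
  simp_rw [add_mul, one_mul]
  rw [Finset.sum_add_distrib, h2, add_zero, h5, ← h3]
  have h6 : complexQuadraticChar F a = ((quadraticChar F a : ℤ) : ℂ) := rfl
  rw [h6, ← mul_assoc, h4, one_mul]

/-- The Gauss sum of a nondegenerate quadratic form over a finite field of odd characteristic. -/
theorem sum_addChar_quadratic (hF : ringChar F ≠ 2) {ψ : AddChar F ℂ} (hψ : ψ.IsPrimitive)
    {n : ℕ} {M : Matrix (Fin n) (Fin n) F} (hM : M.IsSymm) (hdet : M.det ≠ 0) {β : F}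
    (hβ : β ≠ 0) :
    ∑ y : Fin n → F, ψ (β * (y ⬝ᵥ M *ᵥ y)) =
      (quadraticChar F (β ^ n * M.det) : ℂ) * gaussSum (complexQuadraticChar F) ψ ^ n := by
  obtain ⟨P, w, hP, hPw⟩ := exists_diagonalization hF hM
  have hPu : IsUnit P := (isUnit_iff_isUnit_det P).2 (isUnit_iff_ne_zero.2 hP)
  have hbij : Function.Bijective (P *ᵥ ·) :=
    ⟨mulVec_injective_iff_isUnit.2 hPu, mulVec_surjective_iff_isUnit.2 hPu⟩
  have hdetw : P.det ^ 2 * M.det = ∏ i, w i := by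
    rw [← det_diagonal, ← hPw, det_mul, det_mul, det_transpose]; ring
  have hw : ∀ i, w i ≠ 0 := by
    have : ∏ i, w i ≠ 0 := hdetw ▸ mul_ne_zero (pow_ne_zero _ hP) hdet
    exact fun i => (Finset.prod_ne_zero_iff.1 this) i (Finset.mem_univ i)
  have h1 : ∀ z : Fin n → F, ψ (β * ((P *ᵥ z) ⬝ᵥ M *ᵥ (P *ᵥ z))) =
      ∏ i, ψ (β * w i * z i ^ 2) := by
    intro z
    have : (P *ᵥ z) ⬝ᵥ M *ᵥ (P *ᵥ z) = ∑ i, w i * z i ^ 2 := by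
      have h2 : (P *ᵥ z) ⬝ᵥ M *ᵥ (P *ᵥ z) = z ⬝ᵥ (Pᵀ * M * P) *ᵥ z := by
        rw [← mulVec_mulVec, ← mulVec_mulVec, dotProduct_mulVec z Pᵀ, vecMul_transpose]
      rw [h2, hPw]
      simp only [dotProduct, mulVec_diagonal]
      exact Finset.sum_congr rfl fun i _ => by ring
    rw [this, Finset.mul_sum, addChar_sum]
    simp_rw [mul_assoc]
  rw [← hbij.sum_comp fun y => ψ (β * (y ⬝ᵥ M *ᵥ y))]
  simp_rw [h1]
  rw [← Fintype.piFinset_univ,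
    ← Finset.prod_univ_sum (fun _ : Fin n => Finset.univ) (fun i t => ψ (β * w i * t ^ 2))]
  simp_rw [fun i => sum_addChar_mul_sq hF hψ (mul_ne_zero hβ (hw i))]
  rw [Finset.prod_mul_distrib, Finset.prod_const, Finset.card_univ, Fintype.card_fin]
  congr 1
  rw [← Int.cast_prod, ← map_prod, Finset.prod_mul_distrib, Finset.prod_const, Finset.card_univ,
    Fintype.card_fin, ← hdetw, mul_left_comm, map_mul (quadraticChar F) (P.det ^ 2),
    quadraticChar_sq_one' hP, one_mul]

end FiniteField

/-- The Gauss sum of the form modulo an odd prime of good reduction. -/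
theorem quadGaussSum_prime {r : ℕ} {A : Matrix (Fin (2 * r)) (Fin (2 * r)) ℤ} (hA : IsGram A)
    {p : ℕ} [hp : Fact p.Prime] (hp2 : p ≠ 2) (hdet : ¬ (p : ℤ) ∣ A.det) {b : ℤ}
    (hb : ¬ (p : ℤ) ∣ b) :
    quadGaussSum A b p = (jacobiSym ((-1) ^ r * A.det) p : ℂ) * p ^ r := by
  have hF : ringChar (ZMod p) ≠ 2 := by rwa [ZMod.ringChar_zmod_n]
  have h2 : (2 : ZMod p) ≠ 0 := Ring.two_ne_zero hF
  have hb' : (b : ZMod p) ≠ 0 := fun h => hb ((ZMod.intCast_zmod_eq_zero_iff_dvd _ _).1 h)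
  set M : Matrix (Fin (2 * r)) (Fin (2 * r)) (ZMod p) := A.map (Int.cast : ℤ → ZMod p) with hM
  have hMdet : M.det = (A.det : ZMod p) := by
    have := (Int.castRingHom (ZMod p)).map_det A
    simpa [hM, RingHom.mapMatrix_apply] using this.symm
  have hMdet0 : M.det ≠ 0 := by
    rw [hMdet]
    exact fun h => hdet ((ZMod.intCast_zmod_eq_zero_iff_dvd _ _).1 h)
  have hMsymm : M.IsSymm := by
    ext i j
    rw [transpose_apply, hM, map_apply, map_apply, hA.symm.apply]
  have hψ := ZMod.isPrimitive_stdAddChar p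
  -- `Q(y)` is one half of `y' A y`, so it is `2⁻¹ (y' A y)` modulo `p`
  have hterm : ∀ y : Fin (2 * r) → ZMod p, e (b * intQuad A (lift y) / p) =
      ZMod.stdAddChar ((b : ZMod p) * 2⁻¹ * (y ⬝ᵥ M *ᵥ y)) := by
    intro y
    have h1 : ((b * intQuad A (lift y) : ℤ) : ZMod p) = (b : ZMod p) * 2⁻¹ * (y ⬝ᵥ M *ᵥ y) := by
      have h3 : y ⬝ᵥ M *ᵥ y = ((lift y ⬝ᵥ A *ᵥ lift y : ℤ) : ZMod p) := by
        simp [dotProduct, mulVec, lift, hM]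
      rw [h3, ← two_mul_intQuad hA]
      push_cast
      field_simp
    rw [← h1, ZMod.stdAddChar_coe, e]
    congr 1
    push_cast
    ring
  rw [quadGaussSum]
  simp_rw [hterm]
  rw [sum_addChar_quadratic hF hψ hMsymm hMdet0 (mul_ne_zero hb' (inv_ne_zero h2)), pow_mul,
    pow_mul, gaussSum_sq, hMdet]
  · rw [← jacobiSym.legendreSym.to_jacobiSym, legendreSym, map_mul, mul_pow, ZMod.card]
    have e1 : quadraticChar (ZMod p) ((b : ZMod p) ^ 2 * 2⁻¹ ^ 2) = 1 := by
      rw [← mul_pow]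
      exact quadraticChar_sq_one' (mul_ne_zero hb' (inv_ne_zero h2))
    rw [map_pow, e1, one_pow, one_mul]
    have e2 : complexQuadraticChar (ZMod p) (-1) = ((quadraticChar (ZMod p) (-1) : ℤ) : ℂ) := rfl
    rw [e2]
    push_cast
    rw [map_mul, map_pow]
    push_cast
    ring
  · intro h
    refine quadraticChar_ne_one hF ?_
    ext a
    have := congrArg (fun χ : MulChar (ZMod p) ℂ => χ a) h
    simp only [MulChar.ringHomComp_apply, MulChar.one_apply_coe] at this
    have : ((quadraticChar (ZMod p) a : ℤ) : ℂ) = 1 := this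
    rw [MulChar.one_apply_coe]
    exact_mod_cast this
  · exact (quadraticChar_isQuadratic (ZMod p)).comp _
  · exact hψ

/-! ### Evaluation of the multiplier -/

theorem exists_equiv_sum_fin {ι : Type} [Fintype ι] [DecidableEq ι] {m : ℕ}
    (hι : Fintype.card ι = 2 + m) {i j : ι} (hij : i ≠ j) :
    ∃ f : Fin 2 ⊕ Fin m ≃ ι, f (Sum.inl 0) = i ∧ f (Sum.inl 1) = j := by
  let f₀ : Fin 2 ⊕ Fin m ≃ ι := Fintype.equivOfCardEq (by simp [hι])
  let f₁ := f₀.trans (Equiv.swap (f₀ (Sum.inl 0)) i)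
  have h₁ : f₁ (Sum.inl 0) = i := by simp [f₁]
  have hne : f₁ (Sum.inl 1) ≠ i := by
    rw [← h₁]
    exact fun h => by simpa using f₁.injective h
  refine ⟨f₁.trans (Equiv.swap (f₁ (Sum.inl 1)) j), ?_, by simp⟩
  rw [Equiv.trans_apply, h₁]
  exact Equiv.swap_apply_of_ne_of_ne hne.symm hij

/-- Over `ℤ / 4` a symmetric matrix of size `2 r` with even diagonal and unit determinant has
determinant `(-1) ^ r`: it splits off planes of determinant `-1`. In `ℤ / 4` the condition
`2 x = 0` says that `x` is even. -/
theorem det_zmod_four (r : ℕ) : ∀ {ι : Type} [Fintype ι] [DecidableEq ι],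
    Fintype.card ι = 2 * r → ∀ M : Matrix ι ι (ZMod 4), M.IsSymm → (∀ i, 2 * M i i = 0) →
      2 * M.det ≠ 0 → M.det = (-1) ^ r := by
  induction r with
  | zero =>
    intro ι _ _ hι M _ _ _
    have : IsEmpty ι := Fintype.card_eq_zero_iff.1 hι
    simp
  | succ r ih =>
    intro ι _ _ hι M hM hdiag hdet
    obtain ⟨i⟩ : Nonempty ι := Fintype.card_pos_iff.1 (by omega)
    -- a row with even entries only would make the determinant even
    obtain ⟨j, hj⟩ : ∃ j, 2 * M i j ≠ 0 := by
      by_contra! hcon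
      refine hdet ?_
      have h1 := det_updateRow_smul M i (2 : ZMod 4) (M i)
      rw [updateRow_eq_self] at h1
      rw [← h1]
      refine det_eq_zero_of_row_eq_zero i fun k => ?_
      simpa using hcon k
    have hij : i ≠ j := fun h => hj (h ▸ hdiag i)
    obtain ⟨f, hf0, hf1⟩ := exists_equiv_sum_fin (m := 2 * r) (by omega) hij
    set M' := M.submatrix f f with hM'
    have hsymm : ∀ a b, M' a b = M' b a := fun a b => (hM.apply _ _).symm
    have hdiag' : ∀ a, 2 * M' a a = 0 := fun a => hdiag (f a)
    have hMdet : M'.det = M.det := det_submatrix_equiv_self f M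
    have hβ : M' (Sum.inl 0) (Sum.inl 1) ^ 2 = 1 := by
      have h : 2 * M' (Sum.inl 0) (Sum.inl 1) ≠ 0 := by
        simpa [hM', hf0, hf1] using hj
      generalize M' (Sum.inl 0) (Sum.inl 1) = β at h ⊢
      revert β
      decide
    have hαγ : M' (Sum.inl 0) (Sum.inl 0) * M' (Sum.inl 1) (Sum.inl 1) = 0 := by
      have h0 := hdiag' (Sum.inl 0)
      have h1 := hdiag' (Sum.inl 1)
      generalize M' (Sum.inl 0) (Sum.inl 0) = α at h0 ⊢
      generalize M' (Sum.inl 1) (Sum.inl 1) = γ at h1 ⊢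
      revert α γ
      decide
    have hα2 := hdiag' (Sum.inl 0)
    have hγ2 := hdiag' (Sum.inl 1)
    set α := M' (Sum.inl 0) (Sum.inl 0)
    set β := M' (Sum.inl 0) (Sum.inl 1)
    set γ := M' (Sum.inl 1) (Sum.inl 1)
    have hP : M'.toBlocks₁₁ = !![α, β; β, γ] := by
      ext a b
      fin_cases a <;> fin_cases b <;> simp [toBlocks₁₁, α, β, γ, hsymm (Sum.inl 1) (Sum.inl 0)]
    have hPX : M'.toBlocks₁₁ * !![-γ, β; β, -α] = 1 := by
      rw [hP, mul_fin_two, one_fin_two, show α * -γ + β * β = 1 by linear_combination hβ - hαγ,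
        show α * β + β * -α = 0 by ring, show β * -γ + γ * β = 0 by ring,
        show β * β + γ * -α = 1 by linear_combination hβ - hαγ]
    let inst : Invertible M'.toBlocks₁₁ := invertibleOfRightInverse _ _ hPX
    have hinv : ⅟ M'.toBlocks₁₁ = !![-γ, β; β, -α] := rfl
    have hPdet : M'.toBlocks₁₁.det = -1 := by
      rw [hP, det_fin_two_of]
      linear_combination hαγ - hβ
    -- the Schur complement of the plane satisfies the same hypotheses
    set S := M'.toBlocks₂₂ - M'.toBlocks₂₁ * ⅟ M'.toBlocks₁₁ * M'.toBlocks₁₂ with hS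
    have hdetS : M'.det = -1 * S.det := by
      rw [← fromBlocks_toBlocks M', det_fromBlocks₁₁, hPdet]
    have hSe : ∀ a b, S a b = M' (Sum.inr a) (Sum.inr b) -
        (M' (Sum.inl 0) (Sum.inr a) * (-γ * M' (Sum.inl 0) (Sum.inr b) +
            β * M' (Sum.inl 1) (Sum.inr b)) +
          M' (Sum.inl 1) (Sum.inr a) * (β * M' (Sum.inl 0) (Sum.inr b) -
            α * M' (Sum.inl 1) (Sum.inr b))) := by
      intro a b
      rw [hS, hinv]
      simp only [Matrix.sub_apply, mul_apply, Fin.sum_univ_two, toBlocks₂₂, toBlocks₂₁,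
        toBlocks₁₂, of_apply, cons_val', cons_val_zero, cons_val_one, cons_val_fin_one,
        hsymm (Sum.inr a) (Sum.inl 0), hsymm (Sum.inr a) (Sum.inl 1)]
      ring
    have hSdet : S.det = (-1) ^ r := by
      refine ih (by simp) S ?_ ?_ ?_
      · ext a b
        rw [transpose_apply, hSe, hSe, hsymm (Sum.inr b) (Sum.inr a)]
        ring
      · intro a
        rw [hSe]
        have h4 : (4 : ZMod 4) = 0 := by decide
        linear_combination hdiag' (Sum.inr a) + hγ2 * M' (Sum.inl 0) (Sum.inr a) ^ 2 +
          hα2 * M' (Sum.inl 1) (Sum.inr a) ^ 2 -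
          h4 * (β * M' (Sum.inl 0) (Sum.inr a) * M' (Sum.inl 1) (Sum.inr a))
      · intro h0
        refine hdet ?_
        rw [← hMdet, hdetS]
        linear_combination -h0
    rw [← hMdet, hdetS, hSdet]
    ring

/-- The discriminant of a form of even rank is `1` modulo `4` if it is odd. -/
theorem signed_det_mod_four {r : ℕ} {A : Matrix (Fin (2 * r)) (Fin (2 * r)) ℤ} (hA : IsGram A)
    (hodd : Odd A.det) : (-1) ^ r * A.det ≡ 1 [ZMOD 4] := by
  refine (ZMod.intCast_eq_intCast_iff _ _ 4).1 ?_
  have hdet : (A.map (Int.cast : ℤ → ZMod 4)).det = (A.det : ZMod 4) := by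
    have := (Int.castRingHom (ZMod 4)).map_det A
    simpa [RingHom.mapMatrix_apply] using this.symm
  have h := det_zmod_four r (by simp) (A.map (Int.cast : ℤ → ZMod 4)) ?_ ?_ ?_
  · rw [Int.cast_mul, Int.cast_pow, Int.cast_neg, Int.cast_one, ← hdet, h, ← mul_pow]
    simp
  · ext i j
    rw [transpose_apply, map_apply, map_apply, hA.symm.apply]
  · intro i
    obtain ⟨k, hk⟩ := hA.even_diag i
    rw [map_apply, hk]
    have h4 : (4 : ZMod 4) = 0 := by decide
    push_cast
    linear_combination h4 * (k : ZMod 4)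
  · rw [hdet]
    obtain ⟨k, hk⟩ := hodd
    rw [hk]
    have h4 : (4 : ZMod 4) = 0 := by decide
    have : 2 * ((2 * k + 1 : ℤ) : ZMod 4) = 2 := by
      push_cast
      linear_combination h4 * (k : ZMod 4)
    rw [this]
    decide

theorem jacobiSym_eq_of_one_mod_four {D : ℤ} (hD : D ≡ 1 [ZMOD 4]) {m : ℕ} (hm : Odd m) :
    jacobiSym D m = jacobiSym m D.natAbs := by
  have hD4 : D % 4 = 1 := hD
  rcases le_total 0 D with h0 | h0
  · obtain ⟨k, rfl⟩ := Int.eq_ofNat_of_zero_le h0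
    rw [Int.natAbs_natCast]
    exact jacobiSym.quadratic_reciprocity_one_mod_four (by omega) hm
  · obtain ⟨k, hk⟩ := Int.eq_ofNat_of_zero_le (neg_nonneg.2 h0)
    obtain rfl : D = -(k : ℤ) := by omega
    rw [Int.natAbs_neg, Int.natAbs_natCast, jacobiSym.neg _ hm]
    have hk4 : k % 4 = 3 := by omega
    rcases Nat.odd_mod_four_iff.1 (Nat.odd_iff.1 hm) with h | h
    · rw [ZMod.χ₄_nat_one_mod_four h, one_mul]
      exact jacobiSym.quadratic_reciprocity_one_mod_four' (Nat.odd_iff.2 (by omega)) h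
    · rw [ZMod.χ₄_nat_three_mod_four h, jacobiSym.quadratic_reciprocity_three_mod_four hk4 h]
      ring

theorem kroneckerSym_of_odd (D : ℤ) {m : ℕ} (hm : Odd m) : kroneckerSym D m = jacobiSym D m := by
  have : padicValNat 2 m = 0 :=
    padicValNat.eq_zero_of_not_dvd fun h => (Nat.not_even_iff_odd.2 hm) (even_iff_two_dvd.2 h)
  simp [kroneckerSym, this]

/-- Reciprocity for the Kronecker symbol of a discriminant `D ≡ 1 (mod 4)`. -/
theorem kroneckerSym_of_one_mod_four {D : ℤ} (hD : D ≡ 1 [ZMOD 4]) {m : ℕ} (hm : m ≠ 0) :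
    kroneckerSym D m = jacobiSym m D.natAbs := by
  have hD4 : D % 4 = 1 := hD
  have h8 : ZMod.χ₈ (D : ZMod 8) = jacobiSym 2 D.natAbs := by
    rw [jacobiSym.at_two (Nat.odd_iff.2 (by omega))]
    rcases Int.natAbs_eq D with h | h
    · conv_lhs => rw [h]
      simp
    · conv_lhs => rw [h]
      rw [Int.cast_neg, Int.cast_natCast]
      generalize ((D.natAbs : ℕ) : ZMod 8) = t
      revert t
      decide
  have hodd : Odd (m / 2 ^ padicValNat 2 m) := by
    rw [← Nat.not_even_iff_odd, even_iff_two_dvd]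
    have := Nat.not_dvd_ordCompl Nat.prime_two hm
    rwa [Nat.factorization_def _ Nat.prime_two] at this
  rw [kroneckerSym, h8, jacobiSym_eq_of_one_mod_four hD hodd, ← jacobiSym.pow_left,
    ← jacobiSym.mul_left]
  congr 1
  have := Nat.ordProj_mul_ordCompl_eq_self m 2
  rw [Nat.factorization_def _ Nat.prime_two] at this
  exact_mod_cast this

/-- At `τ = i` all the terms of the theta series are positive. -/
theorem jacobiForm_ne_zero {n : ℕ} {A : Matrix (Fin n) (Fin n) ℤ} (hA : IsGram A) :
    jacobiForm A 0 0 I ≠ 0 := by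
  have hterm : ∀ m : Fin n → ℤ, e (I * quad A (toC m + 0) + bil A 0 (toC m + 0)) =
      ((Real.exp (-(2 * Real.pi * intQuad A m)) : ℝ) : ℂ) := by
    intro m
    have h0 : bil A 0 (toC m) = 0 := zero_dotProduct _
    rw [add_zero, h0, add_zero, quad_toC hA.symm hA.even_diag, e, Complex.ofReal_exp]
    congr 1
    push_cast
    linear_combination 2 * Real.pi * (intQuad A m : ℂ) * I_mul_I
  have hs := summable_jacobiForm hA 0 0 (τ := I) (by simp)
  rw [jacobiForm]
  simp_rw [hterm] at hs ⊢
  rw [← Complex.ofReal_tsum, Complex.ofReal_ne_zero]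
  exact ((Complex.summable_ofReal.1 hs).tsum_pos (fun m => (Real.exp_pos _).le) 0
    (Real.exp_pos _)).ne'

theorem jacobiForm_add_int {n : ℕ} {A : Matrix (Fin n) (Fin n) ℤ} (hA : IsGram A) (τ : ℂ) (k : ℤ) :
    jacobiForm A 0 0 (τ + k) = jacobiForm A 0 0 τ := by
  rw [jacobiForm, jacobiForm]
  refine tsum_congr fun m => e_eq_of_sub_eq_int (k * intQuad A m) ?_
  rw [add_zero, quad_toC hA.symm hA.even_diag]
  push_cast
  ring

/-- Translating the argument moves the denominator `d` within its class modulo `c` without changing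
the normalized Gauss sum. -/
theorem quadGaussSum_translate {r : ℕ} {A B : Matrix (Fin (2 * r)) (Fin (2 * r)) ℤ}
    (h : IsDualPair A B N) {a b c k : ℤ} {d d' : ℕ} [NeZero d] [NeZero d']
    (hdet : a * d - b * c = 1) (hc : (N : ℤ) ∣ c) (hd' : (d' : ℤ) = d + c * k) :
    quadGaussSum A b d / d ^ r = quadGaussSum A (b + a * k) d' / d' ^ r := by
  have hdet' : a * d' - (b + a * k) * c = 1 := by rw [hd']; linear_combination hdet
  -- the two matrices send `i + k` and `i` to the same point, where the values can be compared
  have h1 := jacobiForm_transform h hdet hc 0 0 (τ := I + k) (by simp)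
  have h2 := jacobiForm_transform h hdet' hc 0 0 (τ := I) (by simp)
  have hdual : dualVec B N 0 = 0 := by simp [dualVec]
  have hquad : quad A 0 = 0 := by simp [quad, bil]
  have hd'c : (d' : ℂ) = d + c * k := by exact_mod_cast hd'
  have hJ : (c : ℂ) * (I + k) + d = c * I + d' := by rw [hd'c]; ring
  have hJ0 : (c : ℂ) * I + d' ≠ 0 := by
    intro h0
    have hre := congrArg Complex.re h0
    simp at hre
    exact NeZero.ne d' hre
  have hnum : (a : ℂ) * (I + k) + b = a * I + (b + a * k : ℤ) := by push_cast; ring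
  simp only [hdual, hquad, smul_zero, jacobiForm_add_int h.gram, hJ, hnum, mul_zero, zero_div,
    e_zero, one_mul, mul_one] at h1 h2
  have h3 := h1.symm.trans h2
  exact mul_right_cancel₀ (pow_ne_zero r hJ0) (mul_right_cancel₀ (jacobiForm_ne_zero h.gram) h3)

/-- The Gauss sums attached to `Γ₀(N)` are given by the character of the form. -/
theorem quadGaussSum_eq {r : ℕ} {A B : Matrix (Fin (2 * r)) (Fin (2 * r)) ℤ}
    (h : IsDualPair A B N) {a b c : ℤ} {d : ℕ} [NeZero d]
    (hdet : a * d - b * c = 1) (hc : (N : ℤ) ∣ c) :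
    quadGaussSum A b d / d ^ r = (kroneckerSym ((-1) ^ r * A.det) d : ℂ) := by
  have hd0 : d ≠ 0 := NeZero.ne d
  set D : ℤ := (-1) ^ r * A.det with hD
  have hDabs : D.natAbs = A.det.natAbs := by rw [hD, Int.natAbs_mul, Int.natAbs_pow]; simp
  have hNZ : (N : ℤ) ≠ 0 := by exact_mod_cast h.pos.ne'
  have hdetdvd : A.det ∣ (N : ℤ) ^ (2 * r) := by
    refine ⟨B.det, ?_⟩
    rw [← det_mul, h.mul, det_smul, det_one, mul_one, Fintype.card_fin]
  have hdet0 : A.det ≠ 0 := by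
    intro h0
    rw [h0, zero_dvd_iff] at hdetdvd
    exact pow_ne_zero _ hNZ hdetdvd
  have hcopN : IsCoprime (d : ℤ) N := by
    obtain ⟨c', rfl⟩ := hc
    exact ⟨a, -(b * c'), by linear_combination hdet⟩
  have hcopdet : IsCoprime (d : ℤ) A.det := (hcopN.pow_right (n := 2 * r)).of_isCoprime_of_dvd_right
    hdetdvd
  have hcopb : IsCoprime b (d : ℤ) := ⟨-c, a, by linear_combination hdet⟩
  -- a modulus, prime to `d`, that controls both the level and the quadratic symbol
  obtain ⟨q, hq0, hqN, hqdet, hq4, hqd⟩ : ∃ q : ℤ, q ≠ 0 ∧ (N : ℤ) ∣ q ∧ A.det ∣ q ∧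
      (Odd d → 4 * A.det ∣ q) ∧ IsCoprime (d : ℤ) q := by
    by_cases hodd : Odd d
    · refine ⟨4 * A.det * N, by positivity, ⟨4 * A.det, by ring⟩, ⟨4 * N, by ring⟩,
        fun _ => ⟨N, rfl⟩, ?_⟩
      have h4 : IsCoprime (d : ℤ) 4 := by
        have : Nat.Coprime d (2 ^ 2) := (Nat.coprime_two_right.2 hodd).pow_right 2
        exact_mod_cast Nat.isCoprime_iff_coprime.2 this
      exact (h4.mul_right hcopdet).mul_right hcopN
    · exact ⟨A.det * N, mul_ne_zero hdet0 hNZ, ⟨A.det, by ring⟩, ⟨N, rfl⟩, fun h => absurd h hodd,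
        hcopdet.mul_right hcopN⟩
  -- the Gauss sum only involves `b` and `d`, so `c` may be made divisible by `q`; for
  -- the choice of a prime it has to be nonzero
  obtain ⟨a₁, c₁, hdet₁, hqc, hc0⟩ : ∃ a₁ c₁ : ℤ, a₁ * d - b * c₁ = 1 ∧ q ∣ c₁ ∧ c₁ ≠ 0 := by
    obtain ⟨s, t, hst⟩ := hcopb.mul_left hqd.symm
    by_cases hs : s = 0
    · refine ⟨t + b * q, d * q, ?_, ⟨d, by ring⟩,
        mul_ne_zero (by exact_mod_cast hd0) hq0⟩
      rw [hs] at hst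
      linear_combination hst
    · exact ⟨t, -(s * q), by linear_combination hst, ⟨-s, by ring⟩,
        neg_ne_zero.2 (mul_ne_zero hs hq0)⟩
  -- Dirichlet: a prime congruent to `d` modulo `c₁`, large enough not to divide `2 det A`
  obtain ⟨p, hpgt, hp, hpd⟩ := Nat.forall_exists_prime_gt_and_zmodEq (2 + A.det.natAbs)
    (q := c₁.natAbs) (a := d) (by simpa using hc0) (by
      rw [Int.natCast_natAbs]
      exact IsCoprime.abs_right ⟨a₁, -b, by linear_combination hdet₁⟩)
  have hpd' : (p : ℤ) ≡ d [ZMOD c₁] := by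
    rw [Int.modEq_iff_dvd] at hpd ⊢
    exact Int.natAbs_dvd.1 hpd
  obtain ⟨k, hk⟩ : ∃ k, (p : ℤ) = d + c₁ * k := by
    obtain ⟨k, hk⟩ := (Int.modEq_iff_dvd.1 hpd'.symm)
    exact ⟨k, by linarith⟩
  have : Fact p.Prime := ⟨hp⟩
  have hp0 : (p : ℂ) ≠ 0 := Nat.cast_ne_zero.2 hp.ne_zero
  have hpodd : Odd p := hp.odd_of_ne_two (by omega)
  rw [quadGaussSum_translate h hdet₁ (hqN.trans hqc) hk,
    quadGaussSum_prime h.gram (by omega) ?_ ?_, mul_div_assoc, div_self (pow_ne_zero _ hp0),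
    mul_one]
  · rw [← hD, Int.cast_inj]
    by_cases hodd : Odd d
    · rw [kroneckerSym_of_odd D hodd, jacobiSym.mod_right D hpodd, jacobiSym.mod_right D hodd]
      congr 1
      have : (p : ℤ) ≡ d [ZMOD ((4 * D.natAbs : ℕ) : ℤ)] := by
        refine hpd'.of_dvd (dvd_trans ?_ ((hq4 hodd).trans hqc))
        rw [hDabs]
        push_cast
        exact mul_dvd_mul_left 4 (abs_dvd_self _)
      exact (Int.natCast_modEq_iff.1 this)
    · have hdetodd : Odd A.det := by
        rw [← Int.not_even_iff_odd]
        intro heven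
        have h2 : (2 : ℤ) ∣ d := by exact_mod_cast (Nat.not_odd_iff_even.1 hodd).two_dvd
        have := hcopdet.isUnit_of_dvd' h2 heven.two_dvd
        exact absurd this (by decide)
      have hD4 := signed_det_mod_four h.gram hdetodd
      rw [kroneckerSym_of_one_mod_four hD4 hd0, jacobiSym_eq_of_one_mod_four hD4 hpodd]
      refine jacobiSym.mod_left' ?_
      have : (p : ℤ) ≡ d [ZMOD (D.natAbs : ℤ)] := by
        refine hpd'.of_dvd (dvd_trans ?_ (hqdet.trans hqc))
        rw [hDabs]
        push_cast
        exact abs_dvd_self _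
      exact this
  · intro hdvd
    have := Int.natAbs_dvd_natAbs.2 hdvd
    have := Nat.le_of_dvd (by positivity) this
    simp at this
    omega
  · intro hdvd
    have h1 : (p : ℤ) ∣ 1 := by
      have : (1 : ℤ) = a₁ * p - (b + a₁ * k) * c₁ := by rw [hk]; linear_combination -hdet₁
      rw [this]
      exact dvd_sub (dvd_mul_left _ _) (hdvd.mul_right _)
    exact hp.one_lt.ne' (by exact_mod_cast Int.eq_one_of_dvd_one (by positivity) h1)

/-! ### Polynomial weights as Taylor coefficients -/

/-- The theta series with characteristic `x` and weight `⟨l, m + x⟩ ^ k`. For `x = h / N` it is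
`θ(A, h, l, k, τ)`. -/
def shiftSeries (A : Matrix (Fin n) (Fin n) ℤ) (x l : Fin n → ℂ) (k : ℕ) (τ : ℂ) : ℂ :=
  ∑' m : Fin n → ℤ, bil A l (toC m + x) ^ k * e (τ * quad A (toC m + x))

theorem summable_exp_norm_bil (hA : IsGram A) (x l : Fin n → ℂ) {τ : ℂ} (hτ : 0 < τ.im) {R : ℝ}
    (hR : 0 ≤ R) : Summable fun m : Fin n → ℤ =>
      Real.exp (R * ‖bil A l (toC m + x)‖) * ‖e (τ * quad A (toC m + x))‖ := by
  obtain ⟨K, hK0, hK⟩ := norm_bil_toC_add_le A l x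
  refine Summable.of_nonneg_of_le (fun m => by positivity) (fun m => ?_)
    ((summable_exp_quad hA hτ x (R * K)).mul_left (Real.exp (R * (K * ∑ i, ‖x i‖))))
  change _ ≤ _ * (‖e (τ * quad A (toC m + x))‖ * _)
  rw [mul_left_comm, ← Real.exp_add, mul_comm]
  refine mul_le_mul_of_nonneg_left ?_ (norm_nonneg _)
  rw [Real.exp_le_exp]
  have := mul_le_mul_of_nonneg_left (hK m) hR
  linarith

theorem summable_shiftSeries (hA : IsGram A) (x l : Fin n → ℂ) (k : ℕ) {τ : ℂ} (hτ : 0 < τ.im) :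
    Summable fun m : Fin n → ℤ => bil A l (toC m + x) ^ k * e (τ * quad A (toC m + x)) := by
  refine Summable.of_norm_bounded
    ((summable_exp_norm_bil hA x l hτ zero_le_one).mul_left (k.factorial : ℝ)) fun m => ?_
  rw [norm_mul, norm_pow, ← mul_assoc, one_mul]
  refine mul_le_mul_of_nonneg_right ?_ (norm_nonneg _)
  have := Real.pow_div_factorial_le_exp _ (norm_nonneg (bil A l (toC m + x))) k
  rwa [div_le_iff₀' (by positivity)] at this

theorem hasSum_exp (z : ℂ) : HasSum (fun k : ℕ => z ^ k / k.factorial) (cexp z) := by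
  rw [Complex.exp_eq_exp_ℂ]
  exact NormedSpace.expSeries_div_hasSum_exp z

theorem hasSum_real_exp (t : ℝ) : HasSum (fun k : ℕ => t ^ k / k.factorial) (Real.exp t) := by
  rw [Real.exp_eq_exp_ℝ]
  exact NormedSpace.expSeries_div_hasSum_exp t

/-- The two-variable theta series is the exponential generating function of the series with
polynomial weights. -/
theorem hasSum_jacobiForm (hA : IsGram A) (x l : Fin n → ℂ) {τ : ℂ} (hτ : 0 < τ.im) (z : ℂ) :
    HasSum (fun k : ℕ => z ^ k / k.factorial * shiftSeries A x l k τ)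
      (jacobiForm A x ((z / (2 * Real.pi * I)) • l) τ) := by
  set f : (Fin n → ℤ) × ℕ → ℂ := fun p => z ^ p.2 / p.2.factorial *
    (bil A l (toC p.1 + x) ^ p.2 * e (τ * quad A (toC p.1 + x))) with hf
  have hfn : ∀ p, ‖f p‖ = (‖z‖ * ‖bil A l (toC p.1 + x)‖) ^ p.2 / p.2.factorial *
      ‖e (τ * quad A (toC p.1 + x))‖ := by
    intro p
    simp only [hf, norm_mul, norm_div, norm_pow, Complex.norm_natCast]
    ring
  have hin : ∀ m, HasSum (fun k => ‖f (m, k)‖)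
      (Real.exp (‖z‖ * ‖bil A l (toC m + x)‖) * ‖e (τ * quad A (toC m + x))‖) := by
    intro m
    simp only [hfn]
    exact (hasSum_real_exp _).mul_right _
  have hs : Summable f := by
    refine Summable.of_norm ((summable_prod_of_nonneg fun p => norm_nonneg _).2
      ⟨fun m => (hin m).summable, ?_⟩)
    simp_rw [fun m => (hin m).tsum_eq]
    exact summable_exp_norm_bil hA x l hτ (norm_nonneg z)
  have h1 : HasSum (fun m : Fin n → ℤ => e (τ * quad A (toC m + x) +
      bil A ((z / (2 * Real.pi * I)) • l) (toC m + x))) (∑' p, f p) := by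
    refine hs.hasSum.prod_fiberwise fun m => ?_
    have h := (hasSum_exp (z * bil A l (toC m + x))).mul_right (e (τ * quad A (toC m + x)))
    have he : cexp (z * bil A l (toC m + x)) * e (τ * quad A (toC m + x)) =
        e (τ * quad A (toC m + x) + bil A ((z / (2 * Real.pi * I)) • l) (toC m + x)) := by
      rw [e_add, mul_comm, bil_smul_left]
      congr 1
      rw [e]
      congr 1
      have := Complex.two_pi_I_ne_zero
      field_simp
    rw [he] at h
    refine h.congr_fun fun k => ?_
    simp only [hf]
    ring
  rw [jacobiForm, h1.tsum_eq]
  have hfib : ∀ k : ℕ, HasSum (fun m => f (m, k))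
      (z ^ k / k.factorial * shiftSeries A x l k τ) := by
    intro k
    simp only [hf, shiftSeries]
    exact (summable_shiftSeries hA x l k hτ).hasSum.mul_left _
  exact HasSum.prod_fiberwise (f := fun q : ℕ × (Fin n → ℤ) => f (q.2, q.1))
    ((Equiv.prodComm ℕ (Fin n → ℤ)).hasSum_iff.2 hs.hasSum) hfib

/-- The coefficients of an everywhere convergent power series are determined by its sum. -/
theorem coeff_unique {a b : ℕ → ℂ} {F : ℂ → ℂ} (ha : ∀ z, HasSum (fun k => z ^ k * a k) (F z))
    (hb : ∀ z, HasSum (fun k => z ^ k * b k) (F z)) : a = b := by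
  have h : ∀ c : ℕ → ℂ, (∀ z, HasSum (fun k => z ^ k * c k) (F z)) →
      HasFPowerSeriesAt F (FormalMultilinearSeries.ofScalars ℂ c) 0 := by
    intro c hc
    rw [hasFPowerSeriesAt_iff]
    refine Filter.Eventually.of_forall fun z => ?_
    simp_rw [FormalMultilinearSeries.coeff_ofScalars, zero_add, smul_eq_mul]
    exact hc z
  have heq := (h a ha).eq_formalMultilinearSeries (h b hb)
  ext k
  rw [← FormalMultilinearSeries.coeff_ofScalars (p := a), heq,
    FormalMultilinearSeries.coeff_ofScalars]

/-- The expansion of `exp(C z ^ 2)` as a series in all the powers of `z`. -/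
theorem hasSum_exp_sq (C z : ℂ) : HasSum
    (fun i : ℕ => z ^ i * if Even i then C ^ (i / 2) / (i / 2).factorial else 0)
      (cexp (C * z ^ 2)) := by
  have hinj : Function.Injective fun j : ℕ => 2 * j := fun a b h => by simpa using h
  rw [← hinj.hasSum_iff]
  · refine (hasSum_exp (C * z ^ 2)).congr_fun fun j => ?_
    simp only [Function.comp_apply, even_two_mul, if_true]
    rw [Nat.mul_div_cancel_left j two_pos, mul_pow, ← pow_mul]
    ring
  · intro i hi
    rw [if_neg, mul_zero]
    rintro ⟨j, rfl⟩
    exact hi ⟨j, by ring⟩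

theorem sum_antidiagonal_even (C : ℂ) (a : ℕ → ℂ) (k : ℕ) :
    ∑ p ∈ Finset.HasAntidiagonal.antidiagonal k,
      (if Even p.1 then C ^ (p.1 / 2) / (p.1 / 2).factorial else 0) * a p.2 =
      ∑ j ∈ Finset.range (k / 2 + 1), C ^ j / j.factorial * a (k - 2 * j) := by
  simp_rw [ite_mul, zero_mul]
  rw [← Finset.sum_filter]
  symm
  refine Finset.sum_bij (fun j _ => (2 * j, k - 2 * j)) ?_ ?_ ?_ ?_
  · intro j hj
    have := Finset.mem_range.1 hj
    simp only [Finset.mem_filter, Finset.HasAntidiagonal.mem_antidiagonal, even_two_mul, and_true]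
    omega
  · intro i _ j _ hij
    have := congrArg Prod.fst hij
    simpa using this
  · rintro ⟨p, q⟩ hp
    simp only [Finset.mem_filter, Finset.HasAntidiagonal.mem_antidiagonal] at hp
    obtain ⟨hpq, j, hj⟩ := hp
    refine ⟨j, Finset.mem_range.2 (by omega), ?_⟩
    ext <;> simp <;> omega
  · intro j _
    simp

theorem gammaCoef_eq {j k : ℕ} (h : 2 * j ≤ k) :
    gammaCoef j k = (2 : ℂ)⁻¹ ^ j * (k.factorial / (j.factorial * (k - 2 * j).factorial)) := by
  have h1 := Nat.choose_mul_factorial_mul_factorial (n := k) (k := j) (by omega)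
  have h2 := Nat.choose_mul_factorial_mul_factorial (n := k - j) (k := j) (by omega)
  rw [show k - j - j = k - 2 * j by omega] at h2
  have h1' : (k.choose j : ℂ) * j.factorial * (k - j).factorial = k.factorial := by
    exact_mod_cast h1
  have h2' : ((k - j).choose j : ℂ) * j.factorial * (k - 2 * j).factorial = (k - j).factorial := by
    exact_mod_cast h2
  have hj : (j.factorial : ℂ) ≠ 0 := Nat.cast_ne_zero.2 j.factorial_ne_zero
  have hk : ((k - 2 * j).factorial : ℂ) ≠ 0 := Nat.cast_ne_zero.2 (Nat.factorial_ne_zero _)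
  rw [gammaCoef, ← h1', ← h2']
  field_simp

/-- The transformation formula of the series with polynomial weights: the coefficient of `z ^ k` in
`jacobiForm_transform`, for the elliptic variable `z l / (2 π i)`. -/
theorem shiftSeries_transform {r : ℕ} {A B : Matrix (Fin (2 * r)) (Fin (2 * r)) ℤ}
    (h : IsDualPair A B N) {a b c : ℤ} {d : ℕ} [NeZero d]
    (hdet : a * d - b * c = 1) (hc : (N : ℤ) ∣ c) (p : Fin (2 * r) → ℤ) (l : Fin (2 * r) → ℂ)
    (k : ℕ) {τ : ℂ} (hτ : 0 < τ.im) (hγ : 0 < ((a * τ + b) / (c * τ + d)).im) :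
    (c * τ + d) ^ (-((r : ℤ) + (k : ℤ))) *
        shiftSeries A (dualVec B N p) l k ((a * τ + b) / (c * τ + d)) =
      e (a * b * quad A (dualVec B N p)) * (kroneckerSym ((-1) ^ r * A.det) d : ℂ) *
        ∑ j ∈ Finset.range (k / 2 + 1), (quad A l * c / (Real.pi * I * (c * τ + d))) ^ j *
          gammaCoef j k * shiftSeries A (dualVec B N (a • p)) l (k - 2 * j) τ := by
  set J : ℂ := c * τ + d with hJ
  have hJ0 : J ≠ 0 := by intro h0; simp [h0] at hγ
  have hπ : (Real.pi : ℂ) ≠ 0 := Complex.ofReal_ne_zero.2 Real.pi_ne_zero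
  set E : ℂ := e (a * b * quad A (dualVec B N p)) * (kroneckerSym ((-1) ^ r * A.det) d : ℂ) *
    J ^ r with hE
  set C : ℂ := quad A l * c / (2 * Real.pi * I * J) with hC
  set γτ := (a * τ + b) / J
  set S : ℕ → ℂ := fun i => shiftSeries A (dualVec B N p) l i γτ
  set S' : ℕ → ℂ := fun i => shiftSeries A (dualVec B N (a • p)) l i τ with hS'
  -- both sides of the formula for the two-variable series, as power series in `z`
  set F : ℂ → ℂ := fun z => jacobiForm A (dualVec B N p) ((z / J / (2 * Real.pi * I)) • l) γτ
  have hleft : ∀ z, HasSum (fun i : ℕ => z ^ i * ((J ^ i)⁻¹ / i.factorial * S i)) (F z) := by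
    intro z
    refine (hasSum_jacobiForm h.gram (dualVec B N p) l hγ (z / J)).congr_fun fun i => ?_
    rw [div_pow]
    ring
  have hF : ∀ z, F z = E * (cexp (C * z ^ 2) *
      jacobiForm A (dualVec B N (a • p)) ((z / (2 * Real.pi * I)) • l) τ) := by
    intro z
    have h1 := jacobiForm_transform h hdet hc p ((z / (2 * Real.pi * I)) • l) hτ
    rw [quadGaussSum_eq h hdet hc, ← hJ, smul_smul] at h1
    have h2 : J⁻¹ * (z / (2 * Real.pi * I)) = z / J / (2 * Real.pi * I) := by
      field_simp
    have h3 : e (c * quad A ((z / (2 * Real.pi * I)) • l) / J) = cexp (C * z ^ 2) := by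
      rw [e, quad_smul, hC]
      congr 1
      field_simp
    rw [h2, h3] at h1
    simp only [F, hE]
    rw [h1]
    ring
  have hright : ∀ z, HasSum (fun i : ℕ => z ^ i * (E * ∑ j ∈ Finset.range (i / 2 + 1),
      C ^ j / j.factorial * (S' (i - 2 * j) / (i - 2 * j).factorial))) (F z) := by
    intro z
    have h1 := hasSum_exp_sq C z
    have h2 := hasSum_jacobiForm h.gram (dualVec B N (a • p)) l hτ z
    have h3 := (summable_norm_sum_mul_antidiagonal_of_summable_norm h1.summable.norm
      h2.summable.norm).of_norm.hasSum
    rw [← tsum_mul_tsum_eq_tsum_sum_antidiagonal_of_summable_norm h1.summable.norm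
      h2.summable.norm, h1.tsum_eq, h2.tsum_eq] at h3
    rw [hF z]
    refine (h3.mul_left E).congr_fun fun i => ?_
    rw [← sum_antidiagonal_even C (fun q => S' q / q.factorial), mul_left_comm]
    congr 1
    rw [Finset.mul_sum]
    refine Finset.sum_congr rfl fun q hq => ?_
    rw [← Finset.HasAntidiagonal.mem_antidiagonal.1 hq, pow_add]
    simp only [hS']
    ring
  have hcoef := congrFun (coeff_unique hleft hright) k
  have hk : (k.factorial : ℂ) ≠ 0 := Nat.cast_ne_zero.2 k.factorial_ne_zero
  have hz : J ^ (-((r : ℤ) + (k : ℤ))) = (J ^ r)⁻¹ * (J ^ k)⁻¹ := by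
    rw [_root_.zpow_neg, zpow_add₀ hJ0, zpow_natCast, zpow_natCast, mul_inv]
  have hfinal : J ^ (-((r : ℤ) + (k : ℤ))) * S k =
      (J ^ r)⁻¹ * k.factorial * ((J ^ k)⁻¹ / k.factorial * S k) := by
    rw [hz]; field_simp
  change J ^ (-((r : ℤ) + (k : ℤ))) * S k = _
  rw [hfinal, hcoef, hE]
  have hJr : J ^ r ≠ 0 := pow_ne_zero _ hJ0
  rw [show ∀ X Y Z : ℂ, (J ^ r)⁻¹ * k.factorial * (X * Y * J ^ r * Z) = X * Y * (k.factorial * Z) by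
    intro X Y Z; field_simp, Finset.mul_sum]
  congr 1
  refine Finset.sum_congr rfl fun j hj => ?_
  have hj2 : 2 * j ≤ k := by have := Finset.mem_range.1 hj; omega
  have hCj : (quad A l * c / (Real.pi * I * J)) ^ j = 2 ^ j * C ^ j := by
    rw [← mul_pow, hC]
    congr 1
    field_simp
  rw [gammaCoef_eq hj2, hCj, inv_pow]
  simp only [hS']
  have h2j : (2 : ℂ) ^ j ≠ 0 := pow_ne_zero _ two_ne_zero
  field_simp

/-- Parametrization of a residue class modulo `N`. -/
def cosetEquiv (hN : 0 < N) (h : Fin n → ℤ) : (Fin n → ℤ) ≃ coset N h where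
  toFun m := ⟨h + (N : ℤ) • m, fun i => by simp [Int.ModEq]⟩
  invFun m := fun i => (m.1 i - h i) / N
  left_inv m := by
    ext i
    simp [hN.ne']
  right_inv m := by
    ext i
    have : (N : ℤ) ∣ m.1 i - h i := (Int.modEq_iff_dvd.1 (m.2 i).symm)
    simp [Int.mul_ediv_cancel' this]

theorem thetaTerm_cosetEquiv (hN : 0 < N) (h : Fin n → ℤ) (l : Fin n → ℂ) (k : ℕ)
    (τ : UpperHalfPlane) (m : Fin n → ℤ) :
    thetaTerm A N l k τ (cosetEquiv hN h m) =
      (N : ℂ) ^ k * (bil A l (toC m + (N : ℂ)⁻¹ • toC h) ^ k *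
        e (τ * quad A (toC m + (N : ℂ)⁻¹ • toC h))) := by
  have hN0 : (N : ℂ) ≠ 0 := Nat.cast_ne_zero.2 hN.ne'
  have hv : toC (cosetEquiv hN h m : Fin n → ℤ) = (N : ℂ) • (toC m + (N : ℂ)⁻¹ • toC h) := by
    change toC (h + (N : ℤ) • m) = _
    rw [smul_add, smul_smul, mul_inv_cancel₀ hN0, one_smul, toC_add, toC_smul, add_comm]
    simp
  rw [thetaTerm, hv, bil_smul_right, quad_smul, mul_pow, mul_assoc, e]
  congr 4
  field_simp

theorem summable_thetaTerm (hA : IsGram A) (hN : 0 < N) (h : Fin n → ℤ) (l : Fin n → ℂ) (k : ℕ)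
    (τ : UpperHalfPlane) : Summable fun m : coset N h => thetaTerm A N l k τ m := by
  rw [← (cosetEquiv hN h).summable_iff]
  simp only [Function.comp_def, thetaTerm_cosetEquiv]
  exact (summable_shiftSeries hA _ l k τ.im_pos).mul_left _

theorem theta_eq_shiftSeries (hN : 0 < N) (h : Fin n → ℤ) (l : Fin n → ℂ) (k : ℕ)
    (τ : UpperHalfPlane) : theta A N h l k τ = shiftSeries A ((N : ℂ)⁻¹ • toC h) l k τ := by
  have hN0 : (N : ℂ) ^ k ≠ 0 := pow_ne_zero _ (Nat.cast_ne_zero.2 hN.ne')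
  rw [theta, ← (cosetEquiv hN h).tsum_eq]
  simp only [thetaTerm_cosetEquiv]
  rw [tsum_mul_left, ← mul_assoc, one_div, inv_mul_cancel₀ hN0, one_mul, shiftSeries]

theorem thetaQ_eq_shiftSeries (l : Fin n → ℂ) (k : ℕ) (τ : UpperHalfPlane) :
    thetaQ A l k τ = shiftSeries A 0 l k τ := by
  rw [thetaQ, shiftSeries]
  refine tsum_congr fun m => ?_
  rw [add_zero, e]
  congr 2
  ring

theorem IsDualPair.of_isLevel (hA : IsGram A) (hN : IsLevel A N) :
    ∃ B : Matrix (Fin n) (Fin n) ℤ, IsDualPair A B N := by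
  obtain ⟨hpos, B, hB, hd⟩ := hN.1
  exact ⟨B, hA, hpos, hB, hd⟩

theorem IsDualPair.dualVec_eq (h : IsDualPair A B N) {v p : Fin n → ℤ}
    (hp : A *ᵥ v = (N : ℤ) • p) : dualVec B N p = (N : ℂ)⁻¹ • toC v := by
  have : B *ᵥ p = v := by
    have h1 : (N : ℤ) • (B *ᵥ p) = (N : ℤ) • v := by
      rw [← mulVec_smul, ← hp, Matrix.mulVec_mulVec, h.mul', smul_mulVec, one_mulVec]
    exact smul_right_injective _ (by exact_mod_cast h.pos.ne' : (N : ℤ) ≠ 0) h1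
  rw [dualVec, this]

/-- The transformation law for `θ(A, h, l, k, τ)`. If `A h = N p` with `p` integral, then `h / N` is
the vector `A⁻¹ p` of the dual lattice. -/
theorem theta_transform {r : ℕ} {A B : Matrix (Fin (2 * r)) (Fin (2 * r)) ℤ}
    (hAB : IsDualPair A B N) (l : Fin (2 * r) → ℂ) (h : Fin (2 * r) → ℤ)
    (hh : ∀ i, (N : ℤ) ∣ A.mulVec h i) (k : ℕ) (γ : SL(2, ℤ))
    (hγ : γ ∈ CongruenceSubgroup.Gamma0 N) (hd : 0 < γ 1 1) (τ : UpperHalfPlane) :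
    ((γ 1 0 : ℂ) * (τ : ℂ) + (γ 1 1 : ℂ)) ^ (-((r : ℤ) + (k : ℤ))) * theta A N h l k (γ • τ) =
      Complex.exp (2 * Real.pi * Complex.I * quad A (toC h) * (γ 0 0 : ℂ) * (γ 0 1 : ℂ) /
          (N : ℂ) ^ 2) * (epsilonChar A (γ 1 1) : ℂ) *
        ∑ j ∈ Finset.range (k / 2 + 1),
          (quad A l * (γ 1 0 : ℂ) /
              (Real.pi * Complex.I * ((γ 1 0 : ℂ) * (τ : ℂ) + (γ 1 1 : ℂ)))) ^ j *
            gammaCoef j k * theta A N (γ 0 0 • h) l (k - 2 * j) τ := by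
  choose p hp using hh
  have hp' : A *ᵥ h = (N : ℤ) • p := funext hp
  obtain ⟨d, hdd⟩ := Int.eq_ofNat_of_zero_le hd.le
  have : NeZero d := ⟨by rintro rfl; simp [hdd] at hd⟩
  have hdet : γ 0 0 * d - γ 0 1 * γ 1 0 = 1 := by
    rw [← hdd, ← Matrix.det_fin_two]
    exact γ.det_coe
  have hc : (N : ℤ) ∣ γ 1 0 :=
    (ZMod.intCast_zmod_eq_zero_iff_dvd _ _).1 (CongruenceSubgroup.Gamma0_mem.1 hγ)
  have hcoe : ((γ • τ : UpperHalfPlane) : ℂ) =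
      ((γ 0 0 : ℤ) * (τ : ℂ) + (γ 0 1 : ℤ)) / ((γ 1 0 : ℤ) * (τ : ℂ) + (d : ℕ)) := by
    rw [UpperHalfPlane.coe_specialLinearGroup_apply, hdd]
    simp
  have hγim := (γ • τ).im_pos
  change 0 < ((γ • τ : UpperHalfPlane) : ℂ).im at hγim
  rw [hcoe] at hγim
  have hmain := shiftSeries_transform hAB hdet hc p l k τ.im_pos hγim
  have hap : A *ᵥ (γ 0 0 • h) = (N : ℤ) • (γ 0 0 • p) := by
    rw [mulVec_smul, hp', smul_comm]
  rw [hAB.dualVec_eq hp', hAB.dualVec_eq hap, ← hcoe] at hmain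
  simp only [theta_eq_shiftSeries hAB.pos]
  have heps : epsilonChar A (γ 1 1) = kroneckerSym ((-1) ^ r * A.det) d := by
    rw [epsilonChar, hdd, Int.toNat_natCast]
  have hdC : ((γ 1 1 : ℤ) : ℂ) = (d : ℂ) := by rw [hdd]; simp
  have hphase : e ((γ 0 0 : ℤ) * (γ 0 1 : ℤ) * quad A ((N : ℂ)⁻¹ • toC h)) =
      cexp (2 * Real.pi * I * quad A (toC h) * (γ 0 0 : ℂ) * (γ 0 1 : ℂ) / (N : ℂ) ^ 2) := by
    rw [e, quad_smul]
    congr 1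
    have := hAB.ne_zero
    field_simp
  rw [heps, hdC, ← hphase]
  exact hmain

end ThetaTransform

end

theorem theorem3p3 (r : ℕ) (A : Matrix (Fin (2 * r)) (Fin (2 * r)) ℤ)
    (hA : ThetaTransform.IsGram A) (N : ℕ) (hN : ThetaTransform.IsLevel A N)
    (l : Fin (2 * r) → ℂ) :
    -- the theta series converge absolutely
    (∀ (h : Fin (2 * r) → ℤ) (k : ℕ) (τ : UpperHalfPlane),
      Summable fun m : ThetaTransform.coset N h => ThetaTransform.thetaTerm A N l k τ m) ∧
    -- the transformation law
    (∀ (h : Fin (2 * r) → ℤ), (∀ i, (N : ℤ) ∣ A.mulVec h i) →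
      ∀ (k : ℕ) (γ : SL(2, ℤ)), γ ∈ CongruenceSubgroup.Gamma0 N → 0 < γ 1 1 →
      ∀ τ : UpperHalfPlane,
        ((γ 1 0 : ℂ) * (τ : ℂ) + (γ 1 1 : ℂ)) ^ (-((r : ℤ) + (k : ℤ))) *
            ThetaTransform.theta A N h l k (γ • τ) =
          Complex.exp (2 * Real.pi * Complex.I * ThetaTransform.quad A (ThetaTransform.toC h) *
              (γ 0 0 : ℂ) * (γ 0 1 : ℂ) / (N : ℂ) ^ 2) *
            (ThetaTransform.epsilonChar A (γ 1 1) : ℂ) *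
            ∑ j ∈ Finset.range (k / 2 + 1),
              (ThetaTransform.quad A l * (γ 1 0 : ℂ) /
                  (Real.pi * Complex.I * ((γ 1 0 : ℂ) * (τ : ℂ) + (γ 1 1 : ℂ)))) ^ j *
                ThetaTransform.gammaCoef j k *
                ThetaTransform.theta A N (γ 0 0 • h) l (k - 2 * j) τ) ∧
    -- for `h = 0` the series are the ordinary ones
    (∀ (k : ℕ) (τ : UpperHalfPlane),
      ThetaTransform.theta A N 0 l k τ = ThetaTransform.thetaQ A l k τ) ∧
    -- the transformation law for `h = 0`
    (∀ (k : ℕ) (γ : SL(2, ℤ)), γ ∈ CongruenceSubgroup.Gamma0 N → 0 < γ 1 1 →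
      ∀ τ : UpperHalfPlane,
        ((γ 1 0 : ℂ) * (τ : ℂ) + (γ 1 1 : ℂ)) ^ (-((r : ℤ) + (k : ℤ))) *
            ThetaTransform.thetaQ A l k (γ • τ) =
          (ThetaTransform.epsilonChar A (γ 1 1) : ℂ) *
            ∑ j ∈ Finset.range (k / 2 + 1),
              (ThetaTransform.quad A l * (γ 1 0 : ℂ) /
                  (Real.pi * Complex.I * ((γ 1 0 : ℂ) * (τ : ℂ) + (γ 1 1 : ℂ)))) ^ j *
                ThetaTransform.gammaCoef j k *
                ThetaTransform.thetaQ A l (k - 2 * j) τ) := by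
  obtain ⟨B, hAB⟩ := ThetaTransform.IsDualPair.of_isLevel hA hN
  have hzero : ∀ (k : ℕ) (τ : UpperHalfPlane),
      ThetaTransform.theta A N 0 l k τ = ThetaTransform.thetaQ A l k τ := fun k τ => by
    rw [ThetaTransform.theta_eq_shiftSeries hAB.pos, ThetaTransform.thetaQ_eq_shiftSeries,
      ThetaTransform.toC_zero, smul_zero]
  refine ⟨fun h k τ => ThetaTransform.summable_thetaTerm hA hAB.pos h l k τ,
    ThetaTransform.theta_transform hAB l, hzero, fun k γ hγ hd τ => ?_⟩
  have hmain := ThetaTransform.theta_transform hAB l 0 (by simp) k γ hγ hd τ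
  have hquad : ThetaTransform.quad A (0 : Fin (2 * r) → ℂ) = 0 := by
    simp [ThetaTransform.quad, ThetaTransform.bil]
  simpa only [smul_zero, hzero, ThetaTransform.toC_zero, hquad, mul_zero, zero_mul, zero_div,
    Complex.exp_zero, one_mul] using hmain
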